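/- **Theorem 2.4 (Spectral decomposition).** Let $M$ be a compact $C^\infty$ Riemannian manifold (not necessarily connected), and let $\Omega=\mathbb T^\iota=(\mathbb R/\mathbb Z)^\iota$ be a torus of finite dimension $\geq 1$ or of countably infinite dimension. Let $\theta(\omega)=\omega+\alpha$ be an irrational rotation of $\Omega$, that is, $\sum_i c_i\alpha_i\neq 0$ in $\mathbb R/\mathbb Z$ for every nonzero finitely supported integer vector $(c_i)_{i\in\iota}$. Let $\omega\mapsto f_\omega$ be a continuous map from $\Omega$ to the space of $C^2$ diffeomorphisms of $M$ with the $C^2$ topology, and let $\phi(x,\omega)=(f_\omega x,\theta\omega)$ on $M\times\Omega$. Assume: * ($\phi$ is transitive) some orbit $\{\phi^n(x,\omega)\}_{n\in\mathbb Z}$ is dense in $M\times\Omega$; * ($\phi$ is Anosov on fibers) there are a constant $\lambda_0>0$ and a splitting $T_xM=E^u_{(x,\omega)}\oplus E^s_{(x,\omega)}$, depending continuously on $(x,\omega)\in M\times\Omega$, such that for all $(x,\omega)$: $\dim E^u_{(x,\omega)}>0$, $Df_\omega(x)E^u_{(x,\omega)}=E^u_{\phi(x,\omega)}$, $Df_\omega(x)E^s_{(x,\omega)}=E^s_{\phi(x,\omega)}$,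 $|Df_\omega(x)\xi|\ge e^{\lambda_0}|\xi|$ for $\xi\in E^u_{(x,\omega)}$, and $|Df_\omega(x)\eta|\le e^{-\lambda_0}|\eta|$ for $\eta\in E^s_{(x,\omega)}$. Then $M$ has finitely many connected components. Let $M_1,\dots,M_k$ be an enumeration of them without repetition, in any order. There is a unique permutation $\tau$ of $\{1,\dots,k\}$ such that $\tau(1)=1$ and, for every $i\in\{1,\dots,k\}$, $$\phi(M_{\tau(i)}\times\Omega)=M_{\tau(i+1)}\times\Omega,$$ where $i+1$ is read cyclically (so that $k+1$ means $1$). Moreover, for every $i\in\{1,\dots,k\}$, $\phi^k(M_i\times\Omega)=M_i\times\Omega$ and $\phi^k|_{M_i\times\Omega}$ is topologically mixing on fibers: for all nonempty open sets $U,V\subset M_i$ there is $N>0$ such that for all $n\ge N$ and all $\omega\in\Omega$, $$\phi^{kn}(U\times\{\omega\})\cap(V\times\{\theta^{kn}\omega\})\neq\emptyset.$$ -/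

import Mathlib

open Set Topology
open scoped Manifold ContDiff

noncomputable section

namespace FiberAnosov

section Manifold

variable {m : ℕ} {M : Type*} [TopologicalSpace M] [ChartedSpace (EuclideanSpace ℝ (Fin m)) M]
  [IsManifold (𝓡 m) ∞ M]

/-- The second tangent map `T(Tf) : TTM → TTM` of a `C²` diffeomorphism, as a continuous map.
In a chart it is `(x, u, v, z) ↦ (f x, Df u, Df v, D²f (u, v) + Df z)`. -/
def secondTangentMap (f : M ≃ₘ^2⟮𝓡 m, 𝓡 m⟯ M) :
    C(TangentBundle (𝓡 m).tangent (TangentBundle (𝓡 m) M),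
      TangentBundle (𝓡 m).tangent (TangentBundle (𝓡 m) M)) where
  toFun := tangentMap (𝓡 m).tangent (𝓡 m).tangent (tangentMap (𝓡 m) (𝓡 m) f)
  continuous_toFun :=
    (f.contMDiff.contMDiff_tangentMap (m := 1) (by norm_num)).continuous_tangentMap le_rfl

/-- The `C²` topology on the space of `C²` diffeomorphisms of `M` (uniform convergence, on compact
sets, of the map and of its derivatives of order at most two). It is the topology induced by
`f ↦ TTf` from the compact-open topology; for compact `M` it is the topology of the `C²` norm. -/
instance diffTwoTopology : TopologicalSpace (M ≃ₘ^2⟮𝓡 m, 𝓡 m⟯ M) :=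
  TopologicalSpace.induced secondTangentMap inferInstance

/-- The norm `|v|` of a tangent vector for the Riemannian metric `g`. -/
def tangentNorm
    (g : Bundle.ContMDiffRiemannianMetric (𝓡 m) ∞ (EuclideanSpace ℝ (Fin m))
      (fun x : M => TangentSpace (𝓡 m) x))
    (x : M) (v : TangentSpace (𝓡 m) x) : ℝ :=
  √(g.inner x v v)

variable {Ω : Type*} [TopologicalSpace Ω]

/-- The skew product `ϕ(x, w) = (f_w x, θ w)`, as a bijection of `M × Ω`, so that `ϕ ^ n` makes
sense for every integer `n`. -/
def skewProduct (θ : Ω ≃ₜ Ω) (f : Ω → M ≃ₘ^2⟮𝓡 m, 𝓡 m⟯ M) : Equiv.Perm (M × Ω) where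
  toFun p := (f p.2 p.1, θ p.2)
  invFun p := ((f (θ.symm p.2)).symm p.1, θ.symm p.2)
  left_inv p := by simp
  right_inv p := by simp

/-- The splittings `T_x M = E^u(x, w) ⊕ E^s(x, w)` depending continuously on `(x, w)`. Continuity
says that the projection onto `E^u` along `E^s`, as a map of the bundle `TM × Ω` to `TM`, is
continuous. -/
structure IsContinuousSplitting
    (Eu Es : ∀ (x : M), Ω → Submodule ℝ (TangentSpace (𝓡 m) x)) : Prop where
  isCompl : ∀ x w, IsCompl (Eu x w) (Es x w)
  continuous_projection : Continuous fun q : TangentBundle (𝓡 m) M × Ω =>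
    (⟨q.1.proj, Submodule.projection _ _ (isCompl q.1.proj q.2) q.1.snd⟩ : TangentBundle (𝓡 m) M)

/-- The system given by `θ` and `f` is Anosov on fibers, with respect to the Riemannian
metric `g`. -/
def IsAnosovOnFibers
    (g : Bundle.ContMDiffRiemannianMetric (𝓡 m) ∞ (EuclideanSpace ℝ (Fin m))
      (fun x : M => TangentSpace (𝓡 m) x))
    (θ : Ω ≃ₜ Ω) (f : Ω → M ≃ₘ^2⟮𝓡 m, 𝓡 m⟯ M) : Prop :=
  ∃ lam : ℝ, 0 < lam ∧ ∃ Eu Es : ∀ (x : M), Ω → Submodule ℝ (TangentSpace (𝓡 m) x),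
    IsContinuousSplitting Eu Es ∧
    ∀ (x : M) (w : Ω),
      0 < Module.finrank ℝ (Eu x w) ∧
      (Eu x w).map (mfderiv (𝓡 m) (𝓡 m) (f w) x).toLinearMap = Eu (f w x) (θ w) ∧
      (Es x w).map (mfderiv (𝓡 m) (𝓡 m) (f w) x).toLinearMap = Es (f w x) (θ w) ∧
      (∀ v ∈ Eu x w, Real.exp lam * tangentNorm g x v ≤
        tangentNorm g (f w x) (mfderiv (𝓡 m) (𝓡 m) (f w) x v)) ∧
      (∀ v ∈ Es x w, tangentNorm g (f w x) (mfderiv (𝓡 m) (𝓡 m) (f w) x v) ≤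
        Real.exp (-lam) * tangentNorm g x v)

end Manifold

section Topological

/-- A bijection of a topological space is transitive if some (two-sided) orbit is dense. -/
def IsTransitive {X : Type*} [TopologicalSpace X] (φ : Equiv.Perm X) : Prop :=
  ∃ p : X, Dense (range fun n : ℤ => (φ ^ n) p)

/-- The connected component `c` of `M`, as a subset of `M`. -/
def componentSet {M : Type*} [TopologicalSpace M] (c : ConnectedComponents M) : Set M :=
  {x | ConnectedComponents.mk x = c}

/-- Topological mixing on fibers of the restriction to `A × Ω` of a map `ψ` of `M × Ω` over
`ϑ : Ω → Ω`, for an open set `A ⊆ M`. -/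
def IsMixingOnFibers {M Ω : Type*} [TopologicalSpace M] (A : Set M) (ψ : M × Ω → M × Ω)
    (ϑ : Ω → Ω) : Prop :=
  ∀ U V : Set M, IsOpen U → IsOpen V → U.Nonempty → V.Nonempty → U ⊆ A → V ⊆ A →
    ∃ N : ℕ, 0 < N ∧ ∀ n ≥ N, ∀ w : Ω,
      ((ψ^[n] '' (U ×ˢ {w})) ∩ (V ×ˢ {ϑ^[n] w})).Nonempty

/-- The translation by `α` on the torus `(ℝ/ℤ)^ι` is irrational: the coordinates of `α` together
with `1` are linearly independent over `ℚ`, that is, no nontrivial finite integer combination of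
the coordinates vanishes in `ℝ/ℤ`. -/
def IsIrrationalRotation {ι : Type*} (α : ι → UnitAddCircle) : Prop :=
  ∀ c : ι →₀ ℤ, c ≠ 0 → (c.sum fun i n => n • α i) ≠ 0

end Topological

end FiberAnosov

end

noncomputable section

namespace FiberAnosov

/-! ### Chains in the fibers and chain mixing -/

section Chains

/-- A property that holds near the zero set of a continuous function on a compact space holds where
the function is small. -/
theorem exists_pos_forall_of_eventually_near_zero {Y : Type*} [TopologicalSpace Y]
    {K : Set Y} (hK : IsCompact K) {h : Y → ℝ} (hh : Continuous h) {P : Y → Prop}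
    (H : ∀ y ∈ K, h y ≤ 0 → ∀ᶠ z in 𝓝 y, P z) : ∃ δ > 0, ∀ y ∈ K, h y < δ → P y := by
  -- On the compact set of points of `K` without a neighborhood on which `P` holds, `h` is positive,
  -- and its minimum there serves as `δ`.
  have hC : IsCompact (K ∩ (interior {y | P y})ᶜ) := hK.inter_right isOpen_interior.isClosed_compl
  rcases (K ∩ (interior {y | P y})ᶜ).eq_empty_or_nonempty with he | hne
  · refine ⟨1, one_pos, fun y hy _ => ?_⟩
    by_contra hP
    exact he.subset ⟨hy, fun hi => hP (interior_subset hi)⟩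
  · obtain ⟨y₀, hy₀, hmin⟩ := hC.exists_isMinOn hne hh.continuousOn
    refine ⟨h y₀, ?_, fun y hy hlt => ?_⟩
    · by_contra hle
      exact hy₀.2 (mem_interior_iff_mem_nhds.2 (H y₀ hy₀.1 (not_lt.1 hle)))
    · by_contra hP
      exact absurd (hmin ⟨hy, fun hi => hP (interior_subset hi)⟩) (not_le.2 hlt)

section SkewMap

variable {X Ω : Type*} [AddCommGroup Ω]

/-- The skew product `(x, w) ↦ (F w x, w + a)`. -/
def skewMap (F : Ω → X → X) (a : Ω) (p : X × Ω) : X × Ω := (F p.2 p.1, p.2 + a)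

theorem skewMap_iterate_snd (F : Ω → X → X) (a : Ω) (n : ℕ) (p : X × Ω) :
    ((skewMap F a)^[n] p).2 = p.2 + n • a := by
  induction n generalizing p with
  | zero => simp
  | succ n ih =>
    rw [Function.iterate_succ_apply, ih, succ_nsmul]
    simp only [skewMap]
    abel

end SkewMap

variable {X Ω : Type*} [MetricSpace X]

/-- `Reach F a δ n w x y`: a `δ`-chain of length `n` in the fibers, over the orbit of `w` under
the translation by `a`, leads from `x` to `y`. -/
def Reach [Add Ω] (F : Ω → X → X) (a : Ω) (δ : ℝ) : ℕ → Ω → X → X → Prop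
  | 0, _, x, y => x = y
  | n + 1, w, x, y => ∃ z, dist (F w x) z < δ ∧ Reach F a δ n (w + a) z y

theorem exists_modulus [TopologicalSpace Ω] [CompactSpace X] [CompactSpace Ω]
    {F : Ω → X → X} {δ : ℝ} (hF : Continuous fun p : X × Ω => F p.2 p.1) (hδ : 0 < δ) :
    ∃ ρ > 0, ∀ w x y, dist x y < ρ → dist (F w x) (F w y) < δ := by
  have hc : Continuous fun q : (X × X) × Ω => dist (F q.2 q.1.1) (F q.2 q.1.2) :=
    (hF.comp (by fun_prop : Continuous fun q : (X × X) × Ω => (q.1.1, q.2))).dist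
      (hF.comp (by fun_prop : Continuous fun q : (X × X) × Ω => (q.1.2, q.2)))
  obtain ⟨ρ, hρ, h⟩ := exists_pos_forall_of_eventually_near_zero (isCompact_univ)
    (by fun_prop : Continuous fun q : (X × X) × Ω => dist q.1.1 q.1.2)
    (P := fun q => dist (F q.2 q.1.1) (F q.2 q.1.2) < δ) (by
      rintro ⟨⟨x, y⟩, w⟩ - hxy
      obtain rfl : x = y := dist_le_zero.1 hxy
      exact hc.continuousAt.eventually_lt continuousAt_const (by simpa using hδ))
  exact ⟨ρ, hρ, fun w x y hxy => h ((x, y), w) (mem_univ _) hxy⟩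

section Basic

variable [AddCommGroup Ω] {F : Ω → X → X} {a : Ω} {δ : ℝ}

theorem Reach.trans {m n : ℕ} {w : Ω} {x y z : X} (h : Reach F a δ m w x y)
    (h' : Reach F a δ n (w + m • a) y z) : Reach F a δ (m + n) w x z := by
  induction m generalizing w x with
  | zero =>
    cases h
    simpa using h'
  | succ m ih =>
    obtain ⟨t, ht, h⟩ := h
    rw [Nat.succ_add]
    refine ⟨t, ht, ih h ?_⟩
    have : w + a + m • a = w + (m + 1) • a := by rw [succ_nsmul]; abel
    rwa [this]

theorem Reach.exists_seq {n : ℕ} {w : Ω} {x y : X} (h : Reach F a δ n w x y) :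
    ∃ p : ℕ → X, p 0 = x ∧ p n = y ∧ ∀ j < n, dist (F (w + j • a) (p j)) (p (j + 1)) < δ := by
  induction n generalizing w x with
  | zero =>
    cases h
    exact ⟨fun _ => y, rfl, rfl, by simp⟩
  | succ n ih =>
    obtain ⟨z, hz, h⟩ := h
    obtain ⟨p, hp0, hpn, hp⟩ := ih h
    refine ⟨fun j => if j = 0 then x else p (j - 1), by simp, by simp [hpn], ?_⟩
    intro j hj
    rcases j with _ | j
    · simpa [hp0] using hz
    · have := hp j (by omega)
      have e : w + a + j • a = w + (j + 1) • a := by rw [succ_nsmul]; abel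
      rw [e] at this
      simpa using this

theorem reach_iterate (hδ : 0 < δ) (n : ℕ) (x : X) (w : Ω) :
    Reach F a δ n w x ((skewMap F a)^[n] (x, w)).1 := by
  induction n generalizing x w with
  | zero => rfl
  | succ n ih =>
    exact ⟨F w x, by simpa using hδ, by simpa [skewMap] using ih (F w x) (w + a)⟩

theorem reach_iterate_succ (n : ℕ) (x y : X) (w : Ω)
    (h : dist ((skewMap F a)^[n + 1] (x, w)).1 y < δ) : Reach F a δ (n + 1) w x y := by
  have hδ : 0 < δ := dist_nonneg.trans_lt h
  refine (reach_iterate hδ n x w).trans ⟨y, ?_, rfl⟩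
  rw [Function.iterate_succ_apply'] at h
  have := skewMap_iterate_snd F a n (x, w)
  simp only [skewMap] at h this
  rwa [this] at h

/-- A chain for the `k`-th iterate of a skew product is a chain for the skew product. -/
theorem Reach.of_iterate {k : ℕ} {n : ℕ} {w : Ω} {x y : X}
    (h : Reach (fun w x => ((skewMap F a)^[k + 1] (x, w)).1) ((k + 1) • a) δ n w x y) :
    Reach F a δ ((k + 1) * n) w x y := by
  induction n generalizing w x with
  | zero => exact h
  | succ n ih =>
    obtain ⟨z, hz, h⟩ := h
    rw [Nat.mul_succ, Nat.add_comm]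
    exact (reach_iterate_succ k x z w hz).trans (ih h)

/-- An orbit segment can be perturbed to a chain with nearby endpoints over nearby base points. -/
theorem reach_of_orbit_near {ρ : ℝ} (hδ : 0 < δ)
    (hρ : ∀ w x y, dist x y < ρ → dist (F w x) (F w y) < δ / 4) {u : Ω}
    (hu : ∀ w x, dist (F (w + u) x) (F w x) < δ / 4) {n : ℕ} {w : Ω} {x x' y : X}
    (hx : dist x x' < ρ) (hy : dist ((skewMap F a)^[n + 1] (x', w)).1 y < δ / 2) :
    Reach F a δ (n + 1) (w + u) x y := by
  have key : ∀ n : ℕ, ∀ w x', dist ((skewMap F a)^[n + 1] (x', w)).1 y < δ / 2 →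
      Reach F a δ (n + 1) (w + u) x' y := by
    intro n
    induction n with
    | zero =>
      intro w x' hy
      refine ⟨y, ?_, rfl⟩
      have h1 := hu w x'
      have h2 := dist_triangle (F (w + u) x') (F w x') y
      simp only [zero_add, Function.iterate_one, skewMap] at hy
      linarith
    | succ n ih =>
      intro w x' hy
      refine ⟨F w x', by linarith [hu w x'], ?_⟩
      rw [Function.iterate_succ_apply] at hy
      have := ih _ _ hy
      rwa [add_right_comm] at this
  -- A chain with a single jump pays for everything at once: `δ/4` for the start, `δ/4` for the
  -- base, `δ/2` for the end. Otherwise the start is paid for in the first jump and the end in the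
  -- last.
  rcases n with _ | n
  · refine ⟨y, ?_, rfl⟩
    simp only [zero_add, Function.iterate_one, skewMap] at hy
    have h1 := hu w x'
    have h2 := dist_triangle4 (F (w + u) x) (F (w + u) x') (F w x') y
    linarith [hρ (w + u) x x' hx]
  · refine ⟨F w x', ?_, ?_⟩
    · have h2 := dist_triangle (F (w + u) x) (F (w + u) x') (F w x')
      linarith [hρ (w + u) x x' hx, hu w x']
    · rw [Function.iterate_succ_apply] at hy
      have := key n _ _ hy
      rwa [add_right_comm] at this

end Basic

section Topological

variable [AddCommGroup Ω] [TopologicalSpace Ω] [IsTopologicalAddGroup Ω]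
  {F : Ω → X → X} {a : Ω} {δ : ℝ}

/-- The intermediate points can be kept: there are finitely many jumps, each a strict inequality
that depends continuously on the base point. -/
theorem Reach.eventually {n : ℕ} (hF : Continuous fun p : X × Ω => F p.2 p.1) {w : Ω} {x y : X}
    (h : Reach F a δ n w x y) : ∀ᶠ w' in 𝓝 w, Reach F a δ n w' x y := by
  induction n generalizing w x with
  | zero => exact Filter.Eventually.of_forall fun _ => h
  | succ n ih =>
    obtain ⟨z, hz, h⟩ := h
    have h1 : ∀ᶠ w' in 𝓝 w, dist (F w' x) z < δ := by
      have : Continuous fun w' => dist (F w' x) z :=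
        (hF.comp (Continuous.prodMk_right x)).dist continuous_const
      exact this.continuousAt.eventually_lt continuousAt_const hz
    have h2 : ∀ᶠ w' in 𝓝 w, Reach F a δ n (w' + a) z y :=
      (continuous_add_const a).continuousAt.eventually (ih h)
    filter_upwards [h1, h2] with w' h1 h2 using ⟨z, h1, h2⟩

/-- The starting point may move as well because the first jump has slack; a chain of length zero has
none, hence the length `n + 1`. -/
theorem Reach.eventually_prod {n : ℕ} (hF : Continuous fun p : X × Ω => F p.2 p.1) {w : Ω}
    {x y : X} (h : Reach F a δ (n + 1) w x y) :
    ∀ᶠ p : X × Ω in 𝓝 (x, w), Reach F a δ (n + 1) p.2 p.1 y := by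
  obtain ⟨z, hz, h⟩ := h
  have h1 : ∀ᶠ p : X × Ω in 𝓝 (x, w), dist (F p.2 p.1) z < δ :=
    (hF.dist continuous_const).continuousAt.eventually_lt continuousAt_const hz
  have h2 : ∀ᶠ p : X × Ω in 𝓝 (x, w), Reach F a δ n (p.2 + a) z y := by
    have hc : Continuous fun p : X × Ω => p.2 + a := by fun_prop
    exact hc.tendsto (x, w) |>.eventually (h.eventually hF)
  filter_upwards [h1, h2] with p h1 h2 using ⟨z, h1, h2⟩

/-- Modulus of continuity of `F` in the direction of `Ω`, uniform by compactness. -/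
theorem eventually_dist_translate_lt [CompactSpace X] [CompactSpace Ω]
    (hF : Continuous fun p : X × Ω => F p.2 p.1) (hδ : 0 < δ) :
    ∀ᶠ u in 𝓝 (0 : Ω), ∀ w x, dist (F (w + u) x) (F w x) < δ := by
  have : ∀ᶠ u in 𝓝 (0 : Ω), ∀ p ∈ (univ : Set (X × Ω)),
      dist (F (p.2 + u) p.1) (F p.2 p.1) < δ := by
    refine isCompact_univ.eventually_forall_of_forall_eventually fun p _ => ?_
    have hc : Continuous fun q : Ω × (X × Ω) => dist (F (q.2.2 + q.1) q.2.1) (F q.2.2 q.2.1) :=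
      (hF.comp (by fun_prop : Continuous fun q : Ω × (X × Ω) => (q.2.1, q.2.2 + q.1))).dist
        (hF.comp continuous_snd)
    exact hc.continuousAt.eventually_lt continuousAt_const (by simpa using hδ)
  filter_upwards [this] with u hu w x using hu (x, w) (mem_univ _)

/-- Every open set is visited from every open set by a positive iterate. -/
def IsPositivelyTransitive {Y : Type*} [TopologicalSpace Y] (Φ : Y → Y) : Prop :=
  ∀ A B : Set Y, IsOpen A → IsOpen B → A.Nonempty → B.Nonempty →
    ∃ n : ℕ, ∃ p ∈ A, Φ^[n + 1] p ∈ B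

/-- Chains from `x` to all points near `y`, over all base points near `w`, that end over a given
neighborhood of `w'`. -/
theorem exists_reach [CompactSpace X] [CompactSpace Ω]
    (hF : Continuous fun p : X × Ω => F p.2 p.1) (ht : IsPositivelyTransitive (skewMap F a))
    (hδ : 0 < δ) : ∃ W ∈ 𝓝 (0 : Ω), ∀ (x y : X) (w w' : Ω), ∀ O ∈ 𝓝 w', ∃ n : ℕ,
      w + (n + 1) • a ∈ O ∧ ∀ u ∈ W, ∀ y', dist y y' < δ / 4 →
        Reach F a δ (n + 1) (w + u) x y' := by
  obtain ⟨ρ, hρ, hρF⟩ := exists_modulus (δ := δ / 4) hF (by positivity)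
  have hW := eventually_dist_translate_lt (δ := δ / 4) hF (by positivity)
  have hsub : Filter.Tendsto (fun p : Ω × Ω => p.1 - p.2) (𝓝 (0, 0)) (𝓝 0) := by
    have : Continuous fun p : Ω × Ω => p.1 - p.2 := by fun_prop
    simpa using this.tendsto (0, 0)
  have h2 := hsub.eventually hW
  rw [nhds_prod_eq, Filter.eventually_prod_iff] at h2
  obtain ⟨pa, hpa, pb, hpb, hpab⟩ := h2
  -- Transitivity gives an orbit segment over some `v` near `w`, not over `w`. The chain over `w +
  -- u` comes from translating the base by `u - (v - w)`; `W` and `A` are chosen so that this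
  -- difference is always admissible.
  refine ⟨{u | pa u}, hpa, fun x y w w' O hO => ?_⟩
  have h3 : ∀ᶠ q : Ω × Ω in 𝓝 (0, 0), w' + q.1 - q.2 ∈ O := by
    have hc : Continuous fun p : Ω × Ω => w' + p.1 - p.2 := by fun_prop
    exact hc.continuousAt.eventually (by simpa using hO)
  rw [nhds_prod_eq, Filter.eventually_prod_iff] at h3
  obtain ⟨qa, hqa, qb, hqb, hqab⟩ := h3
  obtain ⟨A, hA, hAo, h0A⟩ := eventually_nhds_iff.1 (hpb.and hqb)
  obtain ⟨B, hB, hBo, h0B⟩ := eventually_nhds_iff.1 hqa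
  obtain ⟨n, ⟨x', v⟩, ⟨hx', hv⟩, hn⟩ := ht (Metric.ball x ρ ×ˢ ((fun v => v - w) ⁻¹' A))
    (Metric.ball y (δ / 4) ×ˢ ((fun v => v - w') ⁻¹' B))
    (Metric.isOpen_ball.prod (hAo.preimage (by fun_prop)))
    (Metric.isOpen_ball.prod (hBo.preimage (by fun_prop)))
    ⟨(x, w), by simpa using hρ, by simpa using h0A⟩
    ⟨(y, w'), by simpa using hδ, by simpa using h0B⟩
  obtain ⟨hn1, hn2⟩ := hn
  rw [mem_preimage, skewMap_iterate_snd] at hn2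
  refine ⟨n, ?_, fun u hu y' hy' => ?_⟩
  · have := hqab (hB _ hn2) (hA _ hv).2
    convert this using 1
    simp only
    abel
  · have := reach_of_orbit_near (a := a) hδ hρF (hpab hu (hA _ hv).1) (x := x) (x' := x')
      (n := n) (w := v) (y := y') (by rw [dist_comm]; exact hx') (by
        have := dist_triangle ((skewMap F a)^[n + 1] (x', v)).1 y y'
        rw [Metric.mem_ball] at hn1
        linarith)
    have e : v + (u - (v - w)) = w + u := by abel
    rwa [e] at this

/-- A subset of a net of a connected space that is closed under adjacency is everything. -/
theorem net_eq_of_adjacent [PreconnectedSpace X] {E S : Set X} {r : ℝ} (hSE : S ⊆ E)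
    (hS : S.Nonempty) (hE : ∀ x, ∃ e ∈ E, dist x e < r)
    (h : ∀ e ∈ S, ∀ e' ∈ E, dist e e' < 2 * r → e' ∈ S) : S = E := by
  refine hSE.antisymm fun e' he' => ?_
  by_contra hS'
  obtain ⟨s, hs⟩ := hS
  have hr : 0 < r := by
    obtain ⟨e, _, he⟩ := hE s
    exact dist_nonneg.trans_lt he
  have hU : IsOpen (⋃ e ∈ S, Metric.ball e r) :=
    isOpen_biUnion fun e _ => Metric.isOpen_ball
  have hV : IsOpen (⋃ e ∈ E \ S, Metric.ball e r) :=
    isOpen_biUnion fun e _ => Metric.isOpen_ball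
  obtain ⟨x, -, hx1, hx2⟩ := isPreconnected_univ (α := X) _ _ hU hV
    (by
      intro x _
      obtain ⟨e, he, hxe⟩ := hE x
      by_cases heS : e ∈ S
      · exact Or.inl (mem_biUnion heS hxe)
      · exact Or.inr (mem_biUnion (⟨he, heS⟩ : e ∈ E \ S) hxe))
    ⟨s, mem_univ _, mem_biUnion hs (Metric.mem_ball_self hr)⟩
    ⟨e', mem_univ _, mem_biUnion (⟨he', hS'⟩ : e' ∈ E \ S) (Metric.mem_ball_self hr)⟩
  simp only [mem_iUnion, Metric.mem_ball] at hx1 hx2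
  obtain ⟨e1, he1, h1⟩ := hx1
  obtain ⟨e2, he2, h2⟩ := hx2
  refine he2.2 (h e1 he1 e2 he2.1 ?_)
  have := dist_triangle_left e1 e2 x
  linarith

/-- Some point reaches a whole finite net at the same time. -/
theorem exists_reach_net [CompactSpace X] [CompactSpace Ω] [PreconnectedSpace X] [Nonempty Ω]
    (hF : Continuous fun p : X × Ω => F p.2 p.1) (ht : IsPositivelyTransitive (skewMap F a))
    (hδ : 0 < δ) {E : Set X} (hEf : E.Finite) (hE0 : E.Nonempty)
    (hE : ∀ x, ∃ e ∈ E, dist x e < δ / 8) :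
    ∃ n w z, ∀ e ∈ E, Reach F a δ n w z e := by
  obtain ⟨W, hW, hWreach⟩ := exists_reach hF ht hδ
  let T : ℕ × Ω × X → Set X := fun q => {e ∈ E | Reach F a δ q.1 q.2.1 q.2.2 e}
  have hTE : ∀ q, T q ⊆ E := fun q => sep_subset _ _
  obtain ⟨e₀, he₀⟩ := hE0
  -- A triple (time, base point, start) reaching the largest number of net points; the set reached
  -- is shown to be closed under adjacency.
  have hmax : ∃ q, ∀ q', (T q').ncard ≤ (T q).ncard := by
    have hb : BddAbove (range fun q => (T q).ncard) :=
      ⟨E.ncard, by rintro _ ⟨q, rfl⟩; exact ncard_le_ncard (hTE q) hEf⟩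
    obtain ⟨q, hq⟩ := Nat.sSup_mem (⟨_, (0, Classical.arbitrary Ω, e₀), rfl⟩ :
      (range fun q => (T q).ncard).Nonempty) hb
    exact ⟨q, fun q' => by
      have := le_csSup hb ⟨q', rfl⟩
      rw [← hq] at this
      exact this⟩
  obtain ⟨⟨n₀, w₀, z₀⟩, hmax⟩ := hmax
  set S := T (n₀, w₀, z₀) with hS
  have hTS : ∀ q, S ⊆ T q → T q = S := fun q hq =>
    (eq_of_subset_of_ncard_le hq (hmax q) (hEf.subset (hTE q))).symm
  have hSne : S.Nonempty := by
    rw [← ncard_pos (hEf.subset (hTE _))]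
    refine lt_of_lt_of_le ?_ (hmax (0, w₀, e₀))
    rw [ncard_pos (hEf.subset (hTE _))]
    exact ⟨e₀, he₀, rfl⟩
  have hfin : S.Finite := hEf.subset (hTE _)
  have hS0 : ∀ᶠ w in 𝓝 w₀, ∀ e ∈ S, Reach F a δ n₀ w z₀ e := by
    rw [Filter.eventually_all_finite hfin]
    exact fun e he => he.2.eventually hF
  have hSE : S = E := by
    refine net_eq_of_adjacent (hTE _) hSne hE fun y hy y' hy' hd => ?_
    set w₁ := w₀ + n₀ • a with hw₁
    have hO : {v | v ∈ {w | ∀ e ∈ S, Reach F a δ n₀ w z₀ e} ∧ v - w₀ ∈ W} ∈ 𝓝 w₀ := by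
      refine Filter.inter_mem hS0 ?_
      have hc : Continuous fun v : Ω => v - w₀ := by fun_prop
      exact hc.continuousAt.preimage_mem_nhds (by simpa using hW)
    -- From `y`, a chain goes back to `z₀` over a base point so close to `w₀` that all of `S`,
    -- including `y`, is reached again.
    obtain ⟨m, ⟨hm, hmW⟩, hmR⟩ := hWreach y z₀ w₁ w₀ _ hO
    have hd' : ∀ e ∈ S, Reach F a δ (m + 1 + n₀) w₁ y e := fun e he =>
      (by simpa using hmR 0 (mem_of_mem_nhds hW) z₀ (by simpa using hδ) :
        Reach F a δ (m + 1) w₁ y z₀).trans (hm e he)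
    -- The loop through `z₀` shifts the base by an element of `W`, so a second loop available over
    -- `w₁` is also available after it.
    have hdW : (m + 1 + n₀) • a ∈ W := by
      convert hmW using 1
      rw [hw₁, add_nsmul]
      abel
    have hnear : ∀ᶠ w in 𝓝 w₁, ∀ e ∈ S, Reach F a δ (m + 1 + n₀) w y e := by
      rw [Filter.eventually_all_finite hfin]
      exact fun e he => (hd' e he).eventually hF
    obtain ⟨l, hl, hlR⟩ := hWreach y y w₁ w₁ _ hnear
    -- The two loops at `y` are traversed in either order: with the short one first the chain ends
    -- anywhere in `S`; with it last, its end can be moved to the neighbor `y'`. The total lengths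
    -- agree, so maximality puts `y'` in `S`.
    have h0 : Reach F a δ n₀ w₀ z₀ y := hy.2
    have hA : ∀ e ∈ S, Reach F a δ (n₀ + (l + 1 + (m + 1 + n₀))) w₀ z₀ e := fun e he =>
      h0.trans ((by simpa using hlR 0 (mem_of_mem_nhds hW) y (by simpa using hδ) :
        Reach F a δ (l + 1) w₁ y y).trans (hl e he))
    have hB : Reach F a δ (n₀ + (l + 1 + (m + 1 + n₀))) w₀ z₀ y' := by
      rw [add_comm (l + 1)]
      exact h0.trans ((hd' y hy).trans (hlR _ hdW y' (by linarith)))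
    have := hTS (n₀ + (l + 1 + (m + 1 + n₀)), w₀, z₀) fun e he => ⟨he.1, hA e he⟩
    rw [← this]
    exact ⟨hy', hB⟩
  exact ⟨n₀, w₀, z₀, fun e he => (hSE ▸ he : e ∈ S).2⟩

/-- Chain mixing on fibers. -/
theorem exists_forall_reach [CompactSpace X] [CompactSpace Ω] [PreconnectedSpace X]
    (hF : Continuous fun p : X × Ω => F p.2 p.1) (hsurj : ∀ w, Function.Surjective (F w))
    (ht : IsPositivelyTransitive (skewMap F a)) (hδ : 0 < δ) :
    ∃ N : ℕ, ∀ n ≥ N, ∀ w x y, Reach F a δ n w x y := by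
  rcases isEmpty_or_nonempty X with hX | hX
  · exact ⟨0, fun n _ w x => (hX.false x).elim⟩
  have hΩ : Nonempty Ω := ⟨0⟩
  obtain ⟨ρ, hρ, hρF⟩ := exists_modulus hF hδ
  obtain ⟨E, -, hEf, hEc⟩ := (isCompact_univ (X := X)).finite_cover_balls
    (e := min (δ / 8) ρ) (by positivity)
  have hE : ∀ x, ∃ e ∈ E, dist x e < min (δ / 8) ρ := fun x => by
    simpa only [mem_iUnion, Metric.mem_ball, exists_prop] using hEc (mem_univ x)
  have hE0 : E.Nonempty := by
    obtain ⟨e, he, -⟩ := hE (Classical.arbitrary X)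
    exact ⟨e, he⟩
  obtain ⟨n₀, w₀, z₀, hn₀⟩ := exists_reach_net hF ht hδ hEf hE0 fun x => by
    obtain ⟨e, he, h⟩ := hE x
    exact ⟨e, he, h.trans_le (min_le_left _ _)⟩
  have hO : ∀ᶠ w in 𝓝 w₀, ∀ e ∈ E, Reach F a δ n₀ w z₀ e := by
    rw [Filter.eventually_all_finite hEf]
    exact fun e he => (hn₀ e he).eventually hF
  obtain ⟨W, hW, hWreach⟩ := exists_reach hF ht hδ
  -- One step after the net is reached, every point is: the last net point is replaced by a nearby
  -- preimage of the target, within the modulus `ρ`. Surjectivity then prolongs this to all later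
  -- times.
  have hfull : ∀ n w x, (∀ e ∈ E, Reach F a δ n w x e) → ∀ n' > n, ∀ y, Reach F a δ n' w x y := by
    intro n w x h n' hn'
    induction n', hn' using Nat.le_induction with
    | base =>
      intro y
      obtain ⟨x', rfl⟩ := hsurj (w + n • a) y
      obtain ⟨e, he, hxe⟩ := hE x'
      have h1 : Reach F a δ 1 (w + n • a) e (F (w + n • a) x') :=
        ⟨_, hρF _ _ _ (by rw [dist_comm]; exact hxe.trans_le (min_le_right _ _)), rfl⟩
      exact (h e he).trans h1
    | succ n' _ ih =>
      intro y
      obtain ⟨x', rfl⟩ := hsurj (w + n' • a) y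
      have h1 : Reach F a δ 1 (w + n' • a) x' (F (w + n' • a) x') :=
        ⟨_, by simpa using hδ, rfl⟩
      exact (ih x').trans h1
  have hloc : ∀ p : X × Ω, ∃ N : ℕ, ∀ᶠ q : X × Ω in 𝓝 p, ∀ n ≥ N, ∀ y, Reach F a δ n q.2 q.1 y := by
    rintro ⟨x, w⟩
    obtain ⟨m, hm, hmR⟩ := hWreach x z₀ w w₀ _ hO
    have h1 : ∀ e ∈ E, Reach F a δ (m + n₀ + 1) w x e := fun e he => by
      have := (by simpa using hmR 0 (mem_of_mem_nhds hW) z₀ (by simpa using hδ) :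
        Reach F a δ (m + 1) w x z₀).trans (hm e he)
      rwa [Nat.add_right_comm] at this
    have h2 : ∀ᶠ q : X × Ω in 𝓝 (x, w), ∀ e ∈ E, Reach F a δ (m + n₀ + 1) q.2 q.1 e := by
      rw [Filter.eventually_all_finite hEf]
      exact fun e he => (h1 e he).eventually_prod hF
    refine ⟨m + n₀ + 1 + 1, ?_⟩
    filter_upwards [h2] with q hq n hn y using hfull _ _ _ hq n hn y
  choose N hN using hloc
  obtain ⟨t, -, ht⟩ := (isCompact_univ (X := X × Ω)).elim_nhds_subcover
    (fun p => {q | ∀ n ≥ N p, ∀ y, Reach F a δ n q.2 q.1 y}) fun p _ => hN p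
  refine ⟨t.sup N, fun n hn w x y => ?_⟩
  obtain ⟨p, hp, hq⟩ := mem_iUnion₂.1 (ht (mem_univ (x, w)))
  exact hq n ((Finset.le_sup hp).trans hn) y

end Topological
end Chains

/-! ### Recursive construction of finite sequences -/

section Sequences

theorem exists_seq_forward {E : Type*} (n : ℕ) (P : ℕ → E → Prop) (R : ℕ → E → E → Prop) (x₀ : E)
    (h₀ : P 0 x₀) (h : ∀ j < n, ∀ x, P j x → ∃ y, P (j + 1) y ∧ R j x y) :
    ∃ v : ℕ → E, (∀ j ≤ n, P j (v j)) ∧ ∀ j < n, R j (v j) (v (j + 1)) := by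
  choose! nxt h1 h2 using h
  let v : ℕ → E := fun j => Nat.rec x₀ (fun j x => nxt j x) j
  have hv : ∀ j ≤ n, P j (v j) := fun j => by
    induction j with
    | zero => exact fun _ => h₀
    | succ j ih => exact fun hj => h1 j (by omega) _ (ih (by omega))
  exact ⟨v, hv, fun j hj => h2 j hj _ (hv j hj.le)⟩

/-- The unstable part of a solution is controlled only when pulled back, so it is built from its
last term. -/
theorem exists_seq_backward {E : Type*} (n : ℕ) (P : ℕ → E → Prop) (R : ℕ → E → E → Prop) (x₀ : E)
    (h₀ : P n x₀) (h : ∀ j < n, ∀ y, P (j + 1) y → ∃ x, P j x ∧ R j x y) :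
    ∃ v : ℕ → E, (∀ j ≤ n, P j (v j)) ∧ ∀ j < n, R j (v j) (v (j + 1)) := by
  induction n generalizing P R with
  | zero => exact ⟨fun _ => x₀, fun j hj => by obtain rfl : j = 0 := by omega
                                               exact h₀, by simp⟩
  | succ n ih =>
    obtain ⟨v, hv, hv'⟩ := ih (fun j => P (j + 1)) (fun j => R (j + 1)) h₀
      fun j hj => h (j + 1) (by omega)
    obtain ⟨x, hx, hR⟩ := h 0 (by omega) (v 0) (hv 0 (by omega))
    refine ⟨fun j => Nat.casesOn j x v, ?_, ?_⟩
    · rintro (_ | j) hj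
      exacts [hx, hv j (by omega)]
    · rintro (_ | j) hj
      exacts [hR, hv' j (by omega)]

end Sequences

/-! ### Newton iteration along hyperbolic sequences of maps -/

section Newton

variable {E : Type*} [NormedAddCommGroup E] [NormedSpace ℝ E]

/-- Approximate solutions of the inhomogeneous linear difference equation `v (j + 1) = D j (v j) + b j`
along a hyperbolic sequence of linear maps. -/
theorem exists_approx_solution {K μ η β : ℝ} (hK : 1 ≤ K) (hμ0 : 0 ≤ μ) (hμ : μ < 1) (hη : 0 ≤ η)
    (hβ : 0 ≤ β) {n : ℕ} {D : ℕ → E →L[ℝ] E} {N : ℕ → E → ℝ} {Es Eu : ℕ → Submodule ℝ E}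
    (hN₀ : ∀ j v, ‖v‖ ≤ K * N j v) (hN₁ : ∀ j v, N j v ≤ K * ‖v‖)
    (hNadd : ∀ j v w, N j (v + w) ≤ N j v + N j w)
    (hsplit : ∀ j b, ∃ s ∈ Es j, ∃ t ∈ Eu j, s + t = b ∧ ‖s‖ ≤ K * ‖b‖ ∧ ‖t‖ ≤ K * ‖b‖)
    (hs : ∀ j < n, ∀ v ∈ Es j, ∃ w ∈ Es (j + 1), ‖w - D j v‖ ≤ η * ‖v‖ ∧ N (j + 1) w ≤ μ * N j v)
    (hu : ∀ j < n, ∀ w ∈ Eu (j + 1), ∃ v ∈ Eu j, ‖D j v - w‖ ≤ η * ‖w‖ ∧ N j v ≤ μ * N (j + 1) w)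
    (b : ℕ → E) (hb : ∀ j < n, ‖b j‖ ≤ β) :
    ∃ v : ℕ → E, (∀ j ≤ n, ‖v j‖ ≤ 2 * (K ^ 3 / (1 - μ)) * β) ∧
      ∀ j < n, ‖v (j + 1) - D j (v j) - b j‖ ≤ 4 * (K ^ 3 / (1 - μ)) * η * β := by
  have hμ' : 0 < 1 - μ := by linarith
  have hK0 : 0 < K := by linarith
  -- `R` is the fixed point of `R ↦ μ * R + K ^ 2 * β`, so the bound `N j x ≤ R` propagates along
  -- the recursion in both directions.
  set R := K ^ 2 * β / (1 - μ) with hR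
  have hR0 : 0 ≤ R := by positivity
  have hRe : μ * R + K ^ 2 * β = R := by rw [hR]; field_simp; ring
  have hβR : K ^ 2 * β ≤ R := by nlinarith
  have hN0 : ∀ j, N j 0 ≤ R := fun j => by simpa using (hN₁ j 0).trans (by simpa using hR0)
  choose bs hbs bu hbu hbsu hbsK hbuK using fun j => hsplit (j + 1) (b j)
  have hsN : ∀ j < n, N (j + 1) (bs j) ≤ K ^ 2 * β := fun j hj => by
    have := hN₁ (j + 1) (bs j)
    have h2 := hbsK j
    have h3 := hb j hj
    calc _ ≤ K * ‖bs j‖ := this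
      _ ≤ K * (K * β) := by gcongr; exact h2.trans (by gcongr)
      _ = _ := by ring
  have huN : ∀ j < n, N (j + 1) (-bu j) ≤ K ^ 2 * β := fun j hj => by
    have := hN₁ (j + 1) (-bu j)
    rw [norm_neg] at this
    have h2 := hbuK j
    have h3 := hb j hj
    calc _ ≤ K * ‖bu j‖ := this
      _ ≤ K * (K * β) := by gcongr; exact h2.trans (by gcongr)
      _ = _ := by ring
  obtain ⟨vs, hvs, hvs'⟩ := exists_seq_forward n (fun j x => x ∈ Es j ∧ N j x ≤ R)
    (fun j x y => ‖y - D j x - bs j‖ ≤ η * (K * R)) 0 ⟨zero_mem _, hN0 0⟩ (by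
      rintro j hj x ⟨hx, hxR⟩
      obtain ⟨w, hw, hw1, hw2⟩ := hs j hj x hx
      refine ⟨w + bs j, ⟨add_mem hw (hbs j), ?_⟩, ?_⟩
      · calc _ ≤ N (j + 1) w + N (j + 1) (bs j) := hNadd _ _ _
          _ ≤ μ * R + K ^ 2 * β := add_le_add (hw2.trans (by gcongr)) (hsN j hj)
          _ = R := hRe
      · have : w + bs j - D j x - bs j = w - D j x := by abel
        rw [this]
        exact hw1.trans (by gcongr; exact (hN₀ j x).trans (by gcongr)))
  -- The unstable part starts from zero at time `n`. The vector pulled back is `y - bu j`, of size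
  -- up to `2 * R`, whence the doubled error; the two parts together err by at most `3 * η * K * R`.
  obtain ⟨vu, hvu, hvu'⟩ := exists_seq_backward n (fun j x => x ∈ Eu j ∧ N j x ≤ R)
    (fun j x y => ‖y - D j x - bu j‖ ≤ η * (K * (2 * R))) 0 ⟨zero_mem _, hN0 n⟩ (by
      rintro j hj y ⟨hy, hyR⟩
      obtain ⟨v, hv, hv1, hv2⟩ := hu j hj (y - bu j) (sub_mem hy (hbu j))
      have hyb : N (j + 1) (y - bu j) ≤ R + K ^ 2 * β := by
        rw [sub_eq_add_neg]
        exact (hNadd _ _ _).trans (add_le_add hyR (huN j hj))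
      refine ⟨v, ⟨hv, ?_⟩, ?_⟩
      · calc _ ≤ μ * (R + K ^ 2 * β) := hv2.trans (by gcongr)
          _ ≤ R := by nlinarith [mul_nonneg (sq_nonneg K) hβ]
      · have : y - D j v - bu j = -(D j v - (y - bu j)) := by abel
        rw [this, norm_neg]
        refine hv1.trans ?_
        gcongr
        refine (hN₀ (j + 1) _).trans ?_
        gcongr
        linarith)
  have hKR : K * R = K ^ 3 / (1 - μ) * β := by rw [hR]; field_simp
  refine ⟨fun j => vs j + vu j, fun j hj => ?_, fun j hj => ?_⟩
  · have h1 : ‖vs j‖ ≤ K * R := (hN₀ j _).trans (by gcongr; exact (hvs j hj).2)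
    have h2 : ‖vu j‖ ≤ K * R := (hN₀ j _).trans (by gcongr; exact (hvu j hj).2)
    have := norm_add_le (vs j) (vu j)
    linarith
  · have e : vs (j + 1) + vu (j + 1) - D j (vs j + vu j) - b j =
        (vs (j + 1) - D j (vs j) - bs j) + (vu (j + 1) - D j (vu j) - bu j) := by
      rw [← hbsu j, map_add]; abel
    rw [e]
    have h1 := hvs' j hj
    have h2 := hvu' j hj
    have := norm_add_le (vs (j + 1) - D j (vs j) - bs j) (vu (j + 1) - D j (vu j) - bu j)
    have h3 : η * (K * R) = K ^ 3 / (1 - μ) * η * β := by rw [hKR]; ring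
    have h4 : 0 ≤ η * (K * R) := by positivity
    nlinarith

/-- Approximate orbits of a hyperbolic sequence of maps are shadowed by orbits. -/
theorem exists_shadowing_seq [CompleteSpace E] {K μ : ℝ} (hK : 1 ≤ K) (hμ0 : 0 ≤ μ) (hμ : μ < 1) :
    ∃ η > 0, ∃ C > 0, ∀ r > 0, ∀ (n : ℕ) (u : ℕ → E) (F : ℕ → E → E) (D : ℕ → E →L[ℝ] E)
      (N : ℕ → E → ℝ) (Es Eu : ℕ → Submodule ℝ E),
      (∀ j v, ‖v‖ ≤ K * N j v) → (∀ j v, N j v ≤ K * ‖v‖) →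
      (∀ j v w, N j (v + w) ≤ N j v + N j w) →
      (∀ j b, ∃ s ∈ Es j, ∃ t ∈ Eu j, s + t = b ∧ ‖s‖ ≤ K * ‖b‖ ∧ ‖t‖ ≤ K * ‖b‖) →
      (∀ j < n, ∀ v ∈ Es j, ∃ w ∈ Es (j + 1), ‖w - D j v‖ ≤ η * ‖v‖ ∧ N (j + 1) w ≤ μ * N j v) →
      (∀ j < n, ∀ w ∈ Eu (j + 1), ∃ v ∈ Eu j, ‖D j v - w‖ ≤ η * ‖w‖ ∧ N j v ≤ μ * N (j + 1) w) →
      (∀ j < n, ∀ x ∈ Metric.closedBall (u j) r, ∀ y ∈ Metric.closedBall (u j) r,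
        ‖F j x - F j y - D j (x - y)‖ ≤ η * ‖x - y‖) →
      (∀ j < n, ‖F j (u j) - u (j + 1)‖ ≤ r / C) →
      ∃ z : ℕ → E, (∀ j ≤ n, z j ∈ Metric.closedBall (u j) r) ∧ ∀ j < n, F j (z j) = z (j + 1) := by
  have hμ' : 0 < 1 - μ := by linarith
  have hK0 : 0 < K := by linarith
  set L := K ^ 3 / (1 - μ) with hL
  have hL0 : 0 < L := by positivity
  -- With defect `b`, the correction has norm at most `2 * L * b`, and the new defect is at most `η
  -- * (2 * L * b) + 4 * L * η * b = 6 * L * η * b`, which is `b / 2`. The initial defect `r / (4 *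
  -- L)` makes the corrections sum to at most `r`.
  refine ⟨1 / (12 * L), by positivity, 4 * L, by positivity, ?_⟩
  set η := 1 / (12 * L) with hη
  have hη0 : 0 < η := by positivity
  have hηL : η * L = 1 / 12 := by rw [hη]; field_simp
  intro r hr n u F D N Es Eu hN₀ hN₁ hNadd hsplit hs hu hF h0
  set β := r / (4 * L) with hβ
  have hβ0 : 0 < β := by positivity
  have hβL : β * L = r / 4 := by rw [hβ]; field_simp
  -- The invariant of the iteration. The linear maps `D j` stay those of the initial approximate
  -- orbit, so all iterates must remain in the balls where `F j` is close to `D j`.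
  let Good : ℕ → (ℕ → E) → Prop := fun k z =>
    (∀ j ≤ n, ‖z j - u j‖ ≤ r * (1 - (1 / 2) ^ k)) ∧
      ∀ j < n, ‖F j (z j) - z (j + 1)‖ ≤ β * (1 / 2) ^ k
  have hball : ∀ k z, Good k z → ∀ j ≤ n, z j ∈ Metric.closedBall (u j) r := by
    intro k z hz j hj
    rw [mem_closedBall_iff_norm]
    refine (hz.1 j hj).trans ?_
    have : (0 : ℝ) < (1 / 2) ^ k := by positivity
    nlinarith
  have hstep : ∀ k z, Good k z → ∃ z', Good (k + 1) z' ∧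
      ∀ j ≤ n, ‖z' j - z j‖ ≤ r / 2 * (1 / 2) ^ k := by
    intro k z hz
    have hk : (0 : ℝ) < (1 / 2) ^ k := by positivity
    obtain ⟨v, hv, hv'⟩ := exists_approx_solution (β := β * (1 / 2) ^ k) hK hμ0 hμ hη0.le
      (by positivity) hN₀ hN₁ hNadd hsplit hs hu (fun j => F j (z j) - z (j + 1)) hz.2
    rw [← hL] at hv hv'
    have hv2 : ∀ j ≤ n, ‖v j‖ ≤ r / 2 * (1 / 2) ^ k := fun j hj => (hv j hj).trans_eq (by
      linear_combination (2 * (1 / 2 : ℝ) ^ k) * hβL)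
    have hz' : ∀ j ≤ n, ‖z j + v j - u j‖ ≤ r * (1 - (1 / 2) ^ (k + 1)) := fun j hj => by
      have h1 := norm_add_le (z j - u j) (v j)
      have h2 := hz.1 j hj
      have h3 := hv2 j hj
      have e : z j + v j - u j = z j - u j + v j := by abel
      rw [e, pow_succ]
      linarith
    refine ⟨fun j => z j + v j, ⟨hz', fun j hj => ?_⟩, fun j hj => by simpa using hv2 j hj⟩
    have e : F j (z j + v j) - (z (j + 1) + v (j + 1)) =
        (F j (z j + v j) - F j (z j) - D j (z j + v j - z j)) -
          (v (j + 1) - D j (v j) - (F j (z j) - z (j + 1))) := by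
      rw [add_sub_cancel_left]; abel
    have hb : z j + v j ∈ Metric.closedBall (u j) r := by
      rw [mem_closedBall_iff_norm]
      refine (hz' j hj.le).trans ?_
      have : (0 : ℝ) < (1 / 2) ^ (k + 1) := by positivity
      nlinarith
    have h1 := hF j hj _ hb _ (hball k z hz j hj.le)
    have h2 := hv' j hj
    have h3 := norm_sub_le (F j (z j + v j) - F j (z j) - D j (z j + v j - z j))
      (v (j + 1) - D j (v j) - (F j (z j) - z (j + 1)))
    rw [← e] at h3
    refine h3.trans ((add_le_add h1 h2).trans ?_)
    rw [add_sub_cancel_left]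
    have h4 : η * ‖v j‖ ≤ η * (2 * L * (β * (1 / 2) ^ k)) := by
      gcongr
      exact hv j hj.le
    have h5 : η * (2 * L * (β * (1 / 2) ^ k)) + 4 * L * η * (β * (1 / 2) ^ k) =
        β * (1 / 2) ^ (k + 1) := by
      rw [pow_succ]
      linear_combination (6 * β * (1 / 2 : ℝ) ^ k) * hηL
    linarith
  have hstart : Good 0 u := ⟨fun j _ => by simp, fun j hj => by simpa using h0 j hj⟩
  choose! nxt hnxt hnxt' using hstep
  let Z : ℕ → ℕ → E := fun k => Nat.rec u (fun k z => nxt k z) k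
  have hZ : ∀ k, Good k (Z k) := fun k => by
    induction k with
    | zero => exact hstart
    | succ k ih => exact hnxt k _ ih
  have hcau : ∀ j ≤ n, ∃ x, Filter.Tendsto (fun k => Z k j) Filter.atTop (𝓝 x) := fun j hj => by
    refine cauchySeq_tendsto_of_complete (cauchySeq_of_le_geometric (1 / 2) (r / 2) (by norm_num)
      fun k => ?_)
    rw [dist_comm, dist_eq_norm]
    exact hnxt' k _ (hZ k) j hj
  choose! z hz using hcau
  have hzball : ∀ j ≤ n, z j ∈ Metric.closedBall (u j) r := fun j hj =>
    Metric.isClosed_closedBall.mem_of_tendsto (hz j hj)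
      (Filter.Eventually.of_forall fun k => hball k _ (hZ k) j hj)
  refine ⟨z, hzball, fun j hj => ?_⟩
  -- Continuity of `F j` at the limit comes from its closeness to the continuous linear map `D j` on
  -- the ball.
  have hFz : Filter.Tendsto (fun k => F j (Z k j)) Filter.atTop (𝓝 (F j (z j))) := by
    have h1 : Filter.Tendsto (fun k => D j (Z k j - z j) + (F j (Z k j) - F j (z j) -
        D j (Z k j - z j))) Filter.atTop (𝓝 (0 + 0)) := by
      have h2 : Filter.Tendsto (fun k => Z k j - z j) Filter.atTop (𝓝 0) := by
        simpa using (hz j hj.le).sub_const (z j)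
      refine Filter.Tendsto.add ?_ ?_
      · have h3 := ((D j).continuous.tendsto 0).comp h2
        rwa [map_zero] at h3
      · refine squeeze_zero_norm (fun k => hF j hj _ (hball k _ (hZ k) j hj.le) _
          (hzball j hj.le)) ?_
        simpa using (h2.norm.const_mul η)
    have h3 : Filter.Tendsto (fun k => F j (Z k j) - F j (z j)) Filter.atTop (𝓝 0) := by
      simpa using h1
    simpa using h3.add_const (F j (z j))
  have h1 : Filter.Tendsto (fun k => F j (Z k j) - Z k (j + 1)) Filter.atTop
      (𝓝 (F j (z j) - z (j + 1))) := hFz.sub (hz (j + 1) hj)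
  have h2 : Filter.Tendsto (fun k => F j (Z k j) - Z k (j + 1)) Filter.atTop (𝓝 0) := by
    refine squeeze_zero_norm (fun k => (hZ k).2 j hj) ?_
    simpa using (tendsto_pow_atTop_nhds_zero_of_lt_one (by norm_num : (0 : ℝ) ≤ 1 / 2)
      (by norm_num)).const_mul β
  exact sub_eq_zero.1 (tendsto_nhds_unique h1 h2)

end Newton

/-! ### Tangent vectors, norms, projections and derivatives in charts -/

section Coordinates

variable {m : ℕ} {M : Type*} [TopologicalSpace M] [ChartedSpace (EuclideanSpace ℝ (Fin m)) M]
  [IsManifold (𝓡 m) ∞ M]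
variable {Ω : Type*} [TopologicalSpace Ω]

local notation "𝔼" => EuclideanSpace ℝ (Fin m)

/-- Local compactness makes evaluation jointly continuous for the compact-open topology that defines
the `C²` topology. -/
instance : LocallyCompactSpace (TangentBundle (𝓡 m).tangent (TangentBundle (𝓡 m) M)) := by
  have h1 : LocallyCompactSpace (ModelProd 𝔼 𝔼) :=
    inferInstanceAs (LocallyCompactSpace (𝔼 × 𝔼))
  have : LocallyCompactSpace (ModelProd (ModelProd 𝔼 𝔼) (𝔼 × 𝔼)) :=
    inferInstanceAs (LocallyCompactSpace ((ModelProd 𝔼 𝔼) × (𝔼 × 𝔼)))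
  exact ChartedSpace.locallyCompactSpace (ModelProd (ModelProd 𝔼 𝔼) (𝔼 × 𝔼)) _

/-- The map `Tf` is recovered from `TTf` by evaluating on the zero section and projecting to the
base, so its joint continuity follows from that of `TTf`. -/
theorem continuous_tangentMap_prod {f : Ω → M ≃ₘ^2⟮𝓡 m, 𝓡 m⟯ M} (hf : Continuous f) :
    Continuous fun q : TangentBundle (𝓡 m) M × Ω => tangentMap (𝓡 m) (𝓡 m) (f q.2) q.1 := by
  have h1 : Continuous fun w => secondTangentMap (f w) := continuous_induced_rng.1 hf
  have h2 : Continuous fun q : TangentBundle (𝓡 m).tangent (TangentBundle (𝓡 m) M) × Ω =>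
      secondTangentMap (f q.2) q.1 :=
    (h1.comp continuous_snd).eval continuous_fst
  have h3 : Continuous (Bundle.zeroSection (𝔼 × 𝔼) (TangentSpace (𝓡 m).tangent (M := TangentBundle (𝓡 m) M))) :=
    (Bundle.contMDiff_zeroSection (IB := (𝓡 m).tangent) (n := 0) ℝ (TangentSpace (𝓡 m).tangent (M := TangentBundle (𝓡 m) M))).continuous
  have h4 : Continuous (fun v : TangentBundle (𝓡 m).tangent (TangentBundle (𝓡 m) M) => v.proj) :=
    FiberBundle.continuous_proj _ _
  exact h4.comp (h2.comp ((h3.comp continuous_fst).prodMk continuous_snd))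

theorem continuous_zero_section :
    Continuous fun x : M => (⟨x, 0⟩ : TangentBundle (𝓡 m) M) :=
    (Bundle.contMDiff_zeroSection (IB := (𝓡 m)) (n := 0) ℝ (TangentSpace (𝓡 m) (M := M))).continuous

theorem continuous_apply_prod {f : Ω → M ≃ₘ^2⟮𝓡 m, 𝓡 m⟯ M} (hf : Continuous f) :
    Continuous fun p : M × Ω => f p.2 p.1 :=
  (FiberBundle.continuous_proj 𝔼 (TangentSpace (𝓡 m) (M := M))).comp
    ((continuous_tangentMap_prod hf).comp
    ((continuous_zero_section.comp continuous_fst).prodMk continuous_snd))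

open Bundle

/-- Coordinates of tangent vectors at `x` in the chart at `c`. -/
def coordAt (c x : M) : TangentSpace (𝓡 m) x →L[ℝ] 𝔼 :=
  (trivializationAt 𝔼 (TangentSpace (𝓡 m)) c).continuousLinearMapAt ℝ x

/-- The tangent vector at `x` with given coordinates in the chart at `c`. -/
def ofCoord (c x : M) : 𝔼 →L[ℝ] TangentSpace (𝓡 m) x :=
  (trivializationAt 𝔼 (TangentSpace (𝓡 m)) c).symmL ℝ x

theorem ofCoord_coordAt {c x : M} (hx : x ∈ (chartAt 𝔼 c).source) (v : TangentSpace (𝓡 m) x) :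
    ofCoord c x (coordAt c x v) = v :=
  Trivialization.symmL_continuousLinearMapAt _ (by simpa using hx) v

theorem coordAt_ofCoord {c x : M} (hx : x ∈ (chartAt 𝔼 c).source) (v : 𝔼) :
    coordAt c x (ofCoord c x v) = v :=
  Trivialization.continuousLinearMapAt_symmL _ (by simpa using hx) v

theorem continuousAt_coord {Y : Type*} [TopologicalSpace Y] {c : M} {V : Y → TangentBundle (𝓡 m) M}
    {y : Y} (hV : ContinuousAt V y) (hc : (V y).proj ∈ (chartAt 𝔼 c).source) :
    ContinuousAt (fun z => coordAt c (V z).proj (V z).snd) y := by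
  have h1 : ContinuousAt (fun z => (trivializationAt 𝔼 (TangentSpace (𝓡 m)) c (V z)).2) y :=
    continuousAt_snd.comp (((trivializationAt 𝔼 (TangentSpace (𝓡 m)) c).continuousAt
      (by simpa using hc)).comp hV)
  have hpr : ContinuousAt (fun z => (V z).proj) y :=
    (FiberBundle.continuous_proj 𝔼 (TangentSpace (𝓡 m) (M := M))).continuousAt.comp hV
  refine h1.congr ?_
  filter_upwards [hpr.preimage_mem_nhds ((chartAt 𝔼 c).open_source.mem_nhds hc)] with z hz
  exact (Trivialization.continuousLinearMapAt_apply_of_mem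
    (trivializationAt 𝔼 (TangentSpace (𝓡 m)) c) (R := ℝ) (by simpa using hz) (V z).snd).symm

theorem continuousAt_ofCoord {Y : Type*} [TopologicalSpace Y] {c : M} {b : Y → M} {v : Y → 𝔼}
    {y : Y} (hb : ContinuousAt b y) (hv : ContinuousAt v y) (hc : b y ∈ (chartAt 𝔼 c).source) :
    ContinuousAt (fun z => (⟨b z, ofCoord c (b z) (v z)⟩ : TangentBundle (𝓡 m) M)) y := by
  set e := trivializationAt 𝔼 (TangentSpace (𝓡 m)) c with he
  have h1 : ContinuousAt (fun z => e.toOpenPartialHomeomorph.symm (b z, v z)) y := by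
    have := e.toOpenPartialHomeomorph.symm.continuousAt (x := (b y, v y)) (by simpa [he] using hc)
    exact this.comp (f := fun z => (b z, v z)) (hb.prodMk hv)
  refine h1.congr ?_
  filter_upwards [hb.preimage_mem_nhds ((chartAt 𝔼 c).open_source.mem_nhds hc)] with z hz
  rw [← e.mk_symm (by simpa [he] using hz), ofCoord,
    Trivialization.symmL_apply _ (by simpa using hz)]

/-- The Riemannian norm in the coordinates of the chart at `c`. -/
def coordNorm (g : Bundle.ContMDiffRiemannianMetric (𝓡 m) ∞ 𝔼 (fun x : M => TangentSpace (𝓡 m) x))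
    (c x : M) (v : 𝔼) : ℝ :=
  tangentNorm g x (ofCoord c x v)

/-- The projection onto the unstable space in the coordinates of the chart at `c`. -/
def coordProj {Eu Es : ∀ (x : M), Ω → Submodule ℝ (TangentSpace (𝓡 m) x)}
    (h : IsContinuousSplitting Eu Es) (c x : M) (w : Ω) : 𝔼 →L[ℝ] 𝔼 :=
  LinearMap.toContinuousLinearMap ((coordAt c x).toLinearMap ∘ₗ
    (Submodule.projection _ _ (h.isCompl x w) ∘ₗ (ofCoord c x).toLinearMap))

/-- The derivative of `f` in the coordinates of the charts at `c` and `c'`. -/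
def coordDeriv (f : M → M) (c c' x : M) : 𝔼 →L[ℝ] 𝔼 :=
  (coordAt c' (f x)).comp ((mfderiv (𝓡 m) (𝓡 m) f x).comp (ofCoord c x))

theorem continuousAt_coordNorm
    (g : Bundle.ContMDiffRiemannianMetric (𝓡 m) ∞ 𝔼 (fun x : M => TangentSpace (𝓡 m) x))
    {c x : M} (hx : x ∈ (chartAt 𝔼 c).source) (v : 𝔼) :
    ContinuousAt (fun p : M × 𝔼 => coordNorm g c p.1 p.2) (x, v) := by
  have hv := continuousAt_ofCoord (c := c) (continuousAt_fst (p := (x, v))) continuousAt_snd hx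
  have hg : ContinuousAt (fun p : M × 𝔼 => TotalSpace.mk' (𝔼 →L[ℝ] 𝔼 →L[ℝ] ℝ)
      (E := fun x : M => TangentSpace (𝓡 m) x →L[ℝ] TangentSpace (𝓡 m) x →L[ℝ] ℝ)
      p.1 (g.inner p.1)) (x, v) :=
    (g.contMDiff.continuous.comp continuous_fst).continuousAt
  have : ContinuousAt (fun p : M × 𝔼 => TotalSpace.mk' ℝ (E := Bundle.Trivial M ℝ) p.1
      (g.inner p.1 (ofCoord c p.1 p.2) (ofCoord c p.1 p.2))) (x, v) :=
    hg.clm_bundle_apply₂ (F₁ := 𝔼) (F₂ := 𝔼) hv hv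
  rw [FiberBundle.continuousAt_totalSpace] at this
  exact Real.continuous_sqrt.continuousAt.comp this.2

theorem continuousAt_coordProj {Eu Es : ∀ (x : M), Ω → Submodule ℝ (TangentSpace (𝓡 m) x)}
    (h : IsContinuousSplitting Eu Es) {c x : M} (hx : x ∈ (chartAt 𝔼 c).source) (w : Ω) :
    ContinuousAt (fun p : M × Ω => coordProj h c p.1 p.2) (x, w) := by
  -- In finite dimension, continuity in operator norm can be checked on each vector.
  rw [continuousAt_clm_apply]
  intro v
  have hv := continuousAt_ofCoord (c := c) (continuousAt_fst (p := (x, w)))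
    (continuousAt_const (y := v)) hx
  have h1 : ContinuousAt (fun p : M × Ω => (⟨p.1, Submodule.projection _ _ (h.isCompl p.1 p.2)
      (ofCoord c p.1 v)⟩ : TangentBundle (𝓡 m) M)) (x, w) :=
    ContinuousAt.comp (f := fun p : M × Ω => ((⟨p.1, ofCoord c p.1 v⟩ : TangentBundle (𝓡 m) M), p.2))
      h.continuous_projection.continuousAt (hv.prodMk continuousAt_snd)
  have h2 := continuousAt_coord (c := c) h1 hx
  exact h2

theorem continuousAt_coordDeriv {f : Ω → M ≃ₘ^2⟮𝓡 m, 𝓡 m⟯ M} (hf : Continuous f) {c c' x : M}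
    {w : Ω} (hx : x ∈ (chartAt 𝔼 c).source) (hx' : f w x ∈ (chartAt 𝔼 c').source) :
    ContinuousAt (fun p : M × Ω => coordDeriv (m := m) (f p.2) c c' p.1) (x, w) := by
  rw [continuousAt_clm_apply]
  intro v
  have hv := continuousAt_ofCoord (c := c) (continuousAt_fst (p := (x, w)))
    (continuousAt_const (y := v)) hx
  have h1 : ContinuousAt (fun p : M × Ω => tangentMap (𝓡 m) (𝓡 m) (f p.2)
      (⟨p.1, ofCoord c p.1 v⟩ : TangentBundle (𝓡 m) M)) (x, w) :=
    ContinuousAt.comp (f := fun p : M × Ω => ((⟨p.1, ofCoord c p.1 v⟩ : TangentBundle (𝓡 m) M), p.2))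
      (continuous_tangentMap_prod hf).continuousAt (hv.prodMk continuousAt_snd)
  have h2 := continuousAt_coord (c := c') h1 hx'
  exact h2

theorem ofCoord_coordProj {Eu Es : ∀ (x : M), Ω → Submodule ℝ (TangentSpace (𝓡 m) x)}
    (h : IsContinuousSplitting Eu Es) {c x : M} (hx : x ∈ (chartAt 𝔼 c).source) (w : Ω) (v : 𝔼) :
    ofCoord c x (coordProj h c x w v) =
      Submodule.projection _ _ (h.isCompl x w) (ofCoord c x v) :=
  ofCoord_coordAt hx _

theorem coordProj_eq_self {Eu Es : ∀ (x : M), Ω → Submodule ℝ (TangentSpace (𝓡 m) x)}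
    (h : IsContinuousSplitting Eu Es) {c x : M} (hx : x ∈ (chartAt 𝔼 c).source) {w : Ω} {v : 𝔼}
    (hv : ofCoord c x v ∈ Eu x w) : coordProj h c x w v = v := by
  have : coordProj h c x w v =
    coordAt c x (Submodule.projection _ _ (h.isCompl x w) (ofCoord c x v)) := rfl
  rw [this, Submodule.projection_apply_of_mem_left _ hv, coordAt_ofCoord hx]

theorem coordProj_eq_zero {Eu Es : ∀ (x : M), Ω → Submodule ℝ (TangentSpace (𝓡 m) x)}
    (h : IsContinuousSplitting Eu Es) {c x : M} {w : Ω} {v : 𝔼}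
    (hv : ofCoord c x v ∈ Es x w) : coordProj h c x w v = 0 := by
  have : coordProj h c x w v =
    coordAt c x (Submodule.projection _ _ (h.isCompl x w) (ofCoord c x v)) := rfl
  rw [this, (Submodule.projection_apply_eq_zero_iff _).2 hv, map_zero]

theorem coordProj_mem {Eu Es : ∀ (x : M), Ω → Submodule ℝ (TangentSpace (𝓡 m) x)}
    (h : IsContinuousSplitting Eu Es) {c x : M} (hx : x ∈ (chartAt 𝔼 c).source) (w : Ω) (v : 𝔼) :
    ofCoord c x (coordProj h c x w v) ∈ Eu x w := by
  rw [ofCoord_coordProj h hx]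
  exact Submodule.projection_apply_mem _ _

theorem sub_coordProj_mem {Eu Es : ∀ (x : M), Ω → Submodule ℝ (TangentSpace (𝓡 m) x)}
    (h : IsContinuousSplitting Eu Es) {c x : M} (hx : x ∈ (chartAt 𝔼 c).source) (w : Ω) (v : 𝔼) :
    ofCoord c x (v - coordProj h c x w v) ∈ Es x w := by
  rw [map_sub, ofCoord_coordProj h hx, ← Submodule.projection_apply_eq_zero_iff (h.isCompl x w),
    map_sub, Submodule.projection_apply_of_mem_left _ (Submodule.projection_apply_mem _ _), sub_self]

theorem tangentNorm_nonneg
    (g : Bundle.ContMDiffRiemannianMetric (𝓡 m) ∞ 𝔼 (fun x : M => TangentSpace (𝓡 m) x))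
    (x : M) (v : TangentSpace (𝓡 m) x) : 0 ≤ tangentNorm g x v :=
  Real.sqrt_nonneg _

theorem tangentNorm_pos
    (g : Bundle.ContMDiffRiemannianMetric (𝓡 m) ∞ 𝔼 (fun x : M => TangentSpace (𝓡 m) x))
    {x : M} {v : TangentSpace (𝓡 m) x} (hv : v ≠ 0) : 0 < tangentNorm g x v :=
  Real.sqrt_pos.2 (g.pos x v hv)

theorem tangentNorm_smul
    (g : Bundle.ContMDiffRiemannianMetric (𝓡 m) ∞ 𝔼 (fun x : M => TangentSpace (𝓡 m) x))
    (x : M) (t : ℝ) (v : TangentSpace (𝓡 m) x) :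
    tangentNorm g x (t • v) = |t| * tangentNorm g x v := by
  have : g.inner x (t • v) (t • v) = t ^ 2 * g.inner x v v := by
    rw [map_smul, map_smul, smul_apply, smul_eq_mul, smul_eq_mul]
    ring
  rw [tangentNorm, tangentNorm, this, Real.sqrt_mul (sq_nonneg t), Real.sqrt_sq_eq_abs]

theorem tangentNorm_add_le
    (g : Bundle.ContMDiffRiemannianMetric (𝓡 m) ∞ 𝔼 (fun x : M => TangentSpace (𝓡 m) x))
    (x : M) (v w : TangentSpace (𝓡 m) x) :
    tangentNorm g x (v + w) ≤ tangentNorm g x v + tangentNorm g x w := by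
  let _ : InnerProductSpace.Core ℝ (TangentSpace (𝓡 m) x) := g.toRiemannianMetric.toCore x
  let _ : NormedAddCommGroup (TangentSpace (𝓡 m) x) :=
    InnerProductSpace.Core.toNormedAddCommGroup (𝕜 := ℝ)
  exact norm_add_le v w

theorem coordNorm_smul
    (g : Bundle.ContMDiffRiemannianMetric (𝓡 m) ∞ 𝔼 (fun x : M => TangentSpace (𝓡 m) x))
    (c x : M) (t : ℝ) (v : 𝔼) : coordNorm g c x (t • v) = |t| * coordNorm g c x v := by
  rw [coordNorm, map_smul, tangentNorm_smul, coordNorm]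

theorem coordNorm_add_le
    (g : Bundle.ContMDiffRiemannianMetric (𝓡 m) ∞ 𝔼 (fun x : M => TangentSpace (𝓡 m) x))
    (c x : M) (v w : 𝔼) : coordNorm g c x (v + w) ≤ coordNorm g c x v + coordNorm g c x w := by
  rw [coordNorm, map_add]
  exact tangentNorm_add_le g x _ _

theorem coordNorm_pos
    (g : Bundle.ContMDiffRiemannianMetric (𝓡 m) ∞ 𝔼 (fun x : M => TangentSpace (𝓡 m) x))
    {c x : M} (hx : x ∈ (chartAt 𝔼 c).source) {v : 𝔼} (hv : v ≠ 0) : 0 < coordNorm g c x v := by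
  refine tangentNorm_pos g fun h => hv ?_
  rw [← coordAt_ofCoord hx v, h, map_zero]

/-- The tangent trivializations are the derivatives of the charts, so this is the chain rule. It
identifies `coordDeriv` with the ordinary derivative to which the mean value inequality applies. -/
theorem hasFDerivAt_coord {f : M → M} (hf : MDifferentiable (𝓡 m) (𝓡 m) f) {c c' x : M}
    (hx : x ∈ (chartAt 𝔼 c).source) (hx' : f x ∈ (chartAt 𝔼 c').source) :
    HasFDerivAt (extChartAt (𝓡 m) c' ∘ f ∘ (extChartAt (𝓡 m) c).symm) (coordDeriv f c c' x)
      (extChartAt (𝓡 m) c x) := by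
  refine HasMFDerivAt.hasFDerivAt ?_
  have hxe : x ∈ (extChartAt (𝓡 m) c).source := by simpa using hx
  have e : (extChartAt (𝓡 m) c).symm (extChartAt (𝓡 m) c x) = x :=
    (extChartAt (𝓡 m) c).left_inv hxe
  have h1 : HasMFDerivAt 𝓘(ℝ, 𝔼) (𝓡 m) (extChartAt (𝓡 m) c).symm (extChartAt (𝓡 m) c x)
      (ofCoord c x) := by
    have := (mdifferentiableWithinAt_extChartAt_symm (I := 𝓡 m) (x := c)
      ((extChartAt (𝓡 m) c).map_source hxe)).hasMFDerivWithinAt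
    rw [← TangentBundle.symmL_trivializationAt hx] at this
    rw [ModelWithCorners.range_eq_univ] at this
    exact hasMFDerivWithinAt_univ.1 this
  have h2 : HasMFDerivAt (𝓡 m) (𝓡 m) f ((extChartAt (𝓡 m) c).symm (extChartAt (𝓡 m) c x))
      (mfderiv (𝓡 m) (𝓡 m) f x) := by
    rw [e]
    exact (hf x).hasMFDerivAt
  have h3 : HasMFDerivAt (𝓡 m) 𝓘(ℝ, 𝔼) (extChartAt (𝓡 m) c')
      (f ((extChartAt (𝓡 m) c).symm (extChartAt (𝓡 m) c x))) (coordAt c' (f x)) := by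
    rw [e]
    have := (mdifferentiableAt_extChartAt (I := 𝓡 m) hx').hasMFDerivAt
    rwa [← TangentBundle.continuousLinearMapAt_trivializationAt hx'] at this
  exact HasMFDerivAt.comp _ h3 (HasMFDerivAt.comp _ h2 h1)

end Coordinates

theorem exists_pos_forall_finset {β : Type*} (t : Finset β) (P : β → ℝ → Prop)
    (hmono : ∀ b δ δ', δ' ≤ δ → P b δ → P b δ') (h : ∀ b ∈ t, ∃ δ > 0, P b δ) :
    ∃ δ > 0, ∀ b ∈ t, P b δ := by
  classical
  induction t using Finset.induction_on with
  | empty => exact ⟨1, one_pos, by simp⟩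
  | insert b t _ ih =>
    obtain ⟨δ, hδ, h1⟩ := ih fun b hb => h b (Finset.mem_insert_of_mem hb)
    obtain ⟨δ', hδ', h2⟩ := h b (Finset.mem_insert_self _ _)
    refine ⟨min δ δ', lt_min hδ hδ', fun b' hb' => ?_⟩
    rcases Finset.mem_insert.1 hb' with rfl | hb'
    exacts [hmono _ _ _ (min_le_right _ _) h2, hmono _ _ _ (min_le_left _ _) (h1 b' hb')]

/-! ### Moving stable and unstable vectors to a nearby point -/

section Steps

theorem norm_le_of_close {E : Type*} [NormedAddCommGroup E] {L ε : ℝ} {N₁ N₂ : E → ℝ} (hL : 1 ≤ L) (hε : 2 * L * ε ≤ 1)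
    (h₁ : ∀ v, ‖v‖ ≤ L * N₁ v) (h₄ : ∀ v, |N₂ v - N₁ v| ≤ ε * ‖v‖) (v : E) :
    ‖v‖ ≤ 2 * L * N₂ v := by
  have := (abs_le.1 (h₄ v)).1
  have h1 := h₁ v
  have h2 := norm_nonneg v
  nlinarith

variable {E : Type*} [NormedAddCommGroup E] [NormedSpace ℝ E]

/-- Correction of a stable vector at a nearby point. -/
theorem stable_correction {L ε : ℝ} {N₁ N₂ : E → ℝ} {P₁ P₂ : E →L[ℝ] E} (hL : 1 ≤ L) (hε₀ : 0 ≤ ε)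
    (hε : 2 * L * ε ≤ 1)
    (h₁ : ∀ v, ‖v‖ ≤ L * N₁ v) (h₂ : ∀ v, N₁ v ≤ L * ‖v‖) (h₃ : ∀ v w, N₁ (v + w) ≤ N₁ v + N₁ w)
    (h₄ : ∀ v, |N₂ v - N₁ v| ≤ ε * ‖v‖) (hP : ‖P₂ - P₁‖ ≤ ε) {v : E} (hv : P₂ v = 0) :
    ‖P₁ v‖ ≤ 2 * L * ε * N₂ v ∧ N₁ (v - P₁ v) ≤ (1 + 4 * L ^ 2 * ε) * N₂ v := by
  -- Index 2 refers to the image of a chain point, index 1 to the next chain point; the stable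
  -- vector `v` at the former is replaced by `v - P₁ v`, stable at the latter.
  have hv2 := norm_le_of_close hL hε h₁ h₄ v
  have hPv : ‖P₁ v‖ ≤ ε * ‖v‖ := by
    have := (P₂ - P₁).le_of_opNorm_le hP v
    simpa [hv] using this
  have h0 : 0 ≤ N₂ v := by
    have := norm_nonneg v
    by_contra h
    push Not at h
    nlinarith
  constructor
  · calc _ ≤ ε * ‖v‖ := hPv
      _ ≤ ε * (2 * L * N₂ v) := by gcongr
      _ = _ := by ring
  · have h5 := (abs_le.1 (h₄ v)).1
    have h6 := h₂ (-P₁ v)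
    rw [norm_neg] at h6
    have h7 := h₃ v (-P₁ v)
    rw [← sub_eq_add_neg] at h7
    have h8 : L * ‖P₁ v‖ ≤ L * (ε * ‖v‖) := by gcongr
    have h9 : ε * ‖v‖ ≤ ε * (2 * L * N₂ v) := by gcongr
    have h10 : L * (ε * ‖v‖) ≤ L * (ε * (2 * L * N₂ v)) := by gcongr
    have h11 : ε * (2 * L * N₂ v) ≤ L * (ε * (2 * L * N₂ v)) :=
      le_mul_of_one_le_left (by positivity) hL
    nlinarith

/-- Correction of an unstable vector at a nearby point. -/
theorem unstable_correction {L ε : ℝ} {N₁ N₂ : E → ℝ} {P₁ P₂ : E →L[ℝ] E} (hL : 1 ≤ L)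
    (hε₀ : 0 ≤ ε) (hε : ε ≤ 1)
    (h₁ : ∀ v, ‖v‖ ≤ L * N₁ v) (h₂ : ∀ v, N₁ v ≤ L * ‖v‖) (h₃ : ∀ v w, N₁ (v + w) ≤ N₁ v + N₁ w)
    (h₄ : ∀ v, |N₂ v - N₁ v| ≤ ε * ‖v‖) (hP : ‖P₂ - P₁‖ ≤ ε) {w : E} (hw : P₁ w = w) :
    ‖P₂ w - w‖ ≤ ε * ‖w‖ ∧ N₂ (P₂ w) ≤ (1 + 4 * L ^ 2 * ε) * N₁ w := by
  -- Here the correction goes the other way: `w` is unstable at the next chain point, and `P₂ w` is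
  -- unstable at the image point, where it can be pulled back by the derivative.
  have hPw : ‖P₂ w - w‖ ≤ ε * ‖w‖ := by
    have := (P₂ - P₁).le_of_opNorm_le hP w
    simpa [hw] using this
  refine ⟨hPw, ?_⟩
  have h5 := (abs_le.1 (h₄ (P₂ w))).2
  have h6 := h₂ (P₂ w - w)
  have h7 := h₃ w (P₂ w - w)
  rw [add_sub_cancel] at h7
  have hw0 := norm_nonneg w
  have h8 : ‖P₂ w‖ ≤ 2 * ‖w‖ := by
    have := norm_add_le w (P₂ w - w)
    rw [add_sub_cancel] at this
    nlinarith
  have h9 : L * ‖P₂ w - w‖ ≤ L * (ε * ‖w‖) := by gcongr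
  have h10 : ε * ‖P₂ w‖ ≤ ε * (2 * ‖w‖) := by gcongr
  have h11 : ε * ‖w‖ ≤ L * (ε * ‖w‖) := le_mul_of_one_le_left (by positivity) hL
  have h12 : L * (ε * ‖w‖) ≤ L * (ε * (L * N₁ w)) := by
    gcongr
    exact h₁ w
  have h13 : 0 ≤ L * (ε * (L * N₁ w)) := h12.trans' (by positivity)
  nlinarith

end Steps

/-! ### Uniform estimates in finitely many charts -/

section Charts

variable {m : ℕ} {M : Type*} [MetricSpace M] [CompactSpace M]
  [ChartedSpace (EuclideanSpace ℝ (Fin m)) M] [IsManifold (𝓡 m) ∞ M]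
  {Ω : Type*} [TopologicalSpace Ω]

local notation "𝔼" => EuclideanSpace ℝ (Fin m)

/-- Finitely many charts, with closed subsets of their domains, that cover the manifold. -/
theorem exists_finite_closed_charts (M : Type*) [TopologicalSpace M] [T2Space M]
    [CompactSpace M] [ChartedSpace 𝔼 M] :
    ∃ (t : Finset M) (K : M → Set M) (ch : M → M), (∀ c, IsClosed (K c)) ∧
      (∀ c, K c ⊆ (chartAt 𝔼 c).source) ∧ (∀ x, ch x ∈ t) ∧ ∀ x, x ∈ K (ch x) := by
  obtain ⟨t, ht⟩ := isCompact_univ.elim_nhds_subcover (fun c : M => (chartAt 𝔼 c).source)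
    fun c _ => chart_source_mem_nhds 𝔼 c
  obtain ⟨v, hv, hvc, hvs⟩ := exists_subset_iUnion_closed_subset (ι := t) (s := (univ : Set M))
    (u := fun c => (chartAt 𝔼 (c : M)).source) isClosed_univ (fun c => (chartAt 𝔼 _).open_source)
    (fun x _ => toFinite _) (by
      intro x hx
      obtain ⟨c, hc, hx⟩ := mem_iUnion₂.1 (ht.2 hx)
      exact mem_iUnion.2 ⟨⟨c, hc⟩, hx⟩)
  choose ch hch using fun x => mem_iUnion.1 (hv (mem_univ x))
  classical
  refine ⟨t, fun c => if h : c ∈ t then v ⟨c, h⟩ else ∅, fun x => ch x, fun c => ?_, fun c => ?_,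
    fun x => (ch x).2, fun x => by simpa using hch x⟩
  · dsimp only
    split_ifs
    exacts [hvc _, isClosed_empty]
  · dsimp only
    split_ifs
    exacts [hvs _, empty_subset _]

variable {K : Set M} {c c' : M}

/-- By homogeneity the norms need only be compared on the unit sphere, where compactness applies. -/
theorem exists_coord_bounds [CompactSpace Ω]
    (g : Bundle.ContMDiffRiemannianMetric (𝓡 m) ∞ 𝔼 (fun x : M => TangentSpace (𝓡 m) x))
    {Eu Es : ∀ (x : M), Ω → Submodule ℝ (TangentSpace (𝓡 m) x)}
    (h : IsContinuousSplitting Eu Es) (hK : IsClosed K) (hKs : K ⊆ (chartAt 𝔼 c).source) :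
    ∃ L : ℝ, ∀ x ∈ K, (∀ v, ‖v‖ ≤ L * coordNorm g c x v) ∧ (∀ v, coordNorm g c x v ≤ L * ‖v‖) ∧
      ∀ w, ‖coordProj h c x w‖ ≤ L := by
  have hS : IsCompact (K ×ˢ Metric.sphere (0 : 𝔼) 1) := hK.isCompact.prod (isCompact_sphere _ _)
  have hN : ContinuousOn (fun p : M × 𝔼 => coordNorm g c p.1 p.2) (K ×ˢ Metric.sphere (0 : 𝔼) 1) :=
    fun p hp => (continuousAt_coordNorm g (hKs hp.1) p.2).continuousWithinAt
  have hN0 : ∀ p ∈ K ×ˢ Metric.sphere (0 : 𝔼) 1, coordNorm g c p.1 p.2 ≠ 0 := fun p hp =>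
    (coordNorm_pos g (hKs hp.1) (fun h0 => by simpa [h0] using hp.2)).ne'
  obtain ⟨L₁, hL₁⟩ := hS.exists_bound_of_continuousOn hN
  obtain ⟨L₂, hL₂⟩ := hS.exists_bound_of_continuousOn
    (f := fun p : M × 𝔼 => (coordNorm g c p.1 p.2)⁻¹) (hN.inv₀ hN0)
  obtain ⟨L₃, hL₃⟩ := (hK.isCompact.prod (isCompact_univ (X := Ω))).exists_bound_of_continuousOn
    (f := fun p : M × Ω => coordProj h c p.1 p.2)
    fun p hp => (continuousAt_coordProj h (hKs hp.1) p.2).continuousWithinAt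
  have key : ∀ x ∈ K, ∀ v : 𝔼, v ≠ 0 → coordNorm g c x v ≤ L₁ * ‖v‖ ∧ ‖v‖ ≤ L₂ * coordNorm g c x v := by
    intro x hx v hv
    have hv' : 0 < ‖v‖ := norm_pos_iff.2 hv
    have hp : (x, ‖v‖⁻¹ • v) ∈ K ×ˢ Metric.sphere (0 : 𝔼) 1 :=
      ⟨hx, by simp [norm_smul, hv'.ne']⟩
    have hpos := coordNorm_pos g (hKs hx) hv
    have h1 := hL₁ _ hp
    have h2 := hL₂ _ hp
    simp only [coordNorm_smul, abs_inv, abs_norm, norm_inv, norm_mul, Real.norm_eq_abs,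
      abs_of_pos hpos, mul_inv, inv_inv] at h1 h2
    constructor
    · rwa [inv_mul_le_iff₀ hv', mul_comm] at h1
    · rwa [← div_eq_mul_inv, div_le_iff₀ hpos] at h2
  refine ⟨max L₁ (max L₂ L₃), fun x hx => ⟨fun v => ?_, fun v => ?_, fun w => ?_⟩⟩
  · rcases eq_or_ne v 0 with rfl | hv
    · have := coordNorm_smul g c x 0 0
      simp only [smul_zero, abs_zero, zero_mul] at this
      simp [this]
    · exact (key x hx v hv).2.trans (mul_le_mul_of_nonneg_right
        ((le_max_left _ _).trans (le_max_right _ _)) (coordNorm_pos g (hKs hx) hv).le)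
  · rcases eq_or_ne v 0 with rfl | hv
    · have := coordNorm_smul g c x 0 0
      simp only [smul_zero, abs_zero, zero_mul] at this
      simp [this]
    · exact (key x hx v hv).1.trans (mul_le_mul_of_nonneg_right (le_max_left _ _) (norm_nonneg _))
  · exact (hL₃ (x, w) ⟨hx, mem_univ _⟩).trans ((le_max_right _ _).trans (le_max_right _ _))

/-- Only `q` is confined to `K`: in the application `q` is a point of a chain and `y` the image of
the preceding one, which may lie outside `K`. -/
theorem exists_coord_close [CompactSpace Ω]
    (g : Bundle.ContMDiffRiemannianMetric (𝓡 m) ∞ 𝔼 (fun x : M => TangentSpace (𝓡 m) x))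
    {Eu Es : ∀ (x : M), Ω → Submodule ℝ (TangentSpace (𝓡 m) x)}
    (h : IsContinuousSplitting Eu Es) (hK : IsClosed K) (hKs : K ⊆ (chartAt 𝔼 c).source)
    {ε : ℝ} (hε : 0 < ε) :
    ∃ δ > 0, ∀ q ∈ K, ∀ y, dist y q < δ → y ∈ (chartAt 𝔼 c).source ∧
      ‖extChartAt (𝓡 m) c y - extChartAt (𝓡 m) c q‖ ≤ ε ∧
      (∀ v, |coordNorm g c y v - coordNorm g c q v| ≤ ε * ‖v‖) ∧
      ∀ w, ‖coordProj h c y w - coordProj h c q w‖ ≤ ε := by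
  have hKc := hK.isCompact
  obtain ⟨δ₁, hδ₁, h₁⟩ := exists_pos_forall_of_eventually_near_zero
    (hKc.prod ((isCompact_univ (X := M)).prod (isCompact_closedBall (0 : 𝔼) 1)))
    (h := fun z : M × M × 𝔼 => dist z.2.1 z.1) (by fun_prop)
    (P := fun z => z.2.1 ∈ (chartAt 𝔼 c).source ∧
      ‖extChartAt (𝓡 m) c z.2.1 - extChartAt (𝓡 m) c z.1‖ < ε ∧
      |coordNorm g c z.2.1 z.2.2 - coordNorm g c z.1 z.2.2| < ε) (by
      rintro ⟨q, y, v⟩ ⟨hq, -⟩ hd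
      obtain rfl : y = q := dist_le_zero.1 hd
      have hy := hKs hq
      have hfst : ContinuousAt (fun z : M × M × 𝔼 => z.1) (y, y, v) := continuousAt_fst
      have hsnd : ContinuousAt (fun z : M × M × 𝔼 => z.2.1) (y, y, v) := by fun_prop
      refine Filter.Eventually.and
        (hsnd.preimage_mem_nhds ((chartAt 𝔼 c).open_source.mem_nhds hy)) (.and ?_ ?_)
      · have hc := continuousAt_extChartAt' (I := 𝓡 m) (x := c) (x' := y) (by simpa using hy)
        have h1 : ContinuousAt (fun z : M × M × 𝔼 => ‖extChartAt (𝓡 m) c z.2.1 -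
            extChartAt (𝓡 m) c z.1‖) (y, y, v) :=
          ((ContinuousAt.comp (x := (y, y, v)) (f := fun z : M × M × 𝔼 => z.2.1) hc hsnd).sub
            (ContinuousAt.comp (x := (y, y, v)) (f := fun z : M × M × 𝔼 => z.1) hc hfst)).norm
        exact h1.eventually_lt continuousAt_const (by simpa using hε)
      · have hc := continuousAt_coordNorm g hy v
        have h1 : ContinuousAt (fun z : M × M × 𝔼 => |coordNorm g c z.2.1 z.2.2 -
            coordNorm g c z.1 z.2.2|) (y, y, v) :=
          ((ContinuousAt.comp (x := (y, y, v)) (f := fun z : M × M × 𝔼 => (z.2.1, z.2.2)) hc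
              (by fun_prop)).sub
            (ContinuousAt.comp (x := (y, y, v)) (f := fun z : M × M × 𝔼 => (z.1, z.2.2)) hc
              (by fun_prop))).abs
        exact h1.eventually_lt continuousAt_const (by simpa using hε))
  obtain ⟨δ₂, hδ₂, h₂⟩ := exists_pos_forall_of_eventually_near_zero
    (hKc.prod ((isCompact_univ (X := M)).prod (isCompact_univ (X := Ω))))
    (h := fun z : M × M × Ω => dist z.2.1 z.1) (by fun_prop)
    (P := fun z => ‖coordProj h c z.2.1 z.2.2 - coordProj h c z.1 z.2.2‖ < ε) (by
      rintro ⟨q, y, w⟩ ⟨hq, -⟩ hd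
      obtain rfl : y = q := dist_le_zero.1 hd
      have hc := continuousAt_coordProj h (hKs hq) w
      have h1 : ContinuousAt (fun z : M × M × Ω => ‖coordProj h c z.2.1 z.2.2 -
          coordProj h c z.1 z.2.2‖) (y, y, w) :=
        ((ContinuousAt.comp (x := (y, y, w)) (f := fun z : M × M × Ω => (z.2.1, z.2.2)) hc
            (by fun_prop)).sub
          (ContinuousAt.comp (x := (y, y, w)) (f := fun z : M × M × Ω => (z.1, z.2.2)) hc
            (by fun_prop))).norm
      exact h1.eventually_lt continuousAt_const (by simpa using hε))
  refine ⟨min δ₁ δ₂, lt_min hδ₁ hδ₂, fun q hq y hd => ?_⟩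
  have hd₁ := hd.trans_le (min_le_left _ _)
  obtain ⟨ha, hb, -⟩ := h₁ (q, y, 0) ⟨hq, mem_univ _, by simp⟩ hd₁
  refine ⟨ha, hb.le, fun v => ?_, fun w =>
    (h₂ (q, y, w) ⟨hq, mem_univ _, mem_univ _⟩ (hd.trans_le (min_le_right _ _))).le⟩
  rcases eq_or_ne v 0 with rfl | hv
  · have h0 : ∀ x, coordNorm g c x 0 = 0 := fun x => by
      have := coordNorm_smul g c x 0 0
      simpa only [smul_zero, abs_zero, zero_mul] using this
    simp [h0]
  · have hv' : 0 < ‖v‖ := norm_pos_iff.2 hv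
    obtain ⟨-, -, h3⟩ := h₁ (q, y, ‖v‖⁻¹ • v)
      ⟨hq, mem_univ _, by simp [norm_smul, hv'.ne']⟩ hd₁
    simp only [coordNorm_smul, abs_inv, abs_norm, ← mul_sub, abs_mul] at h3
    rw [inv_mul_lt_iff₀ hv', mul_comm] at h3
    exact h3.le

/-- Uniform linear approximation of the maps `f w` in charts. -/
theorem exists_coord_approx [CompactSpace Ω] {f : Ω → M ≃ₘ^2⟮𝓡 m, 𝓡 m⟯ M} (hf : Continuous f)
    {K' : Set M} (hK : IsClosed K) (hKs : K ⊆ (chartAt 𝔼 c).source) (hK' : IsClosed K')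
    (hKs' : K' ⊆ (chartAt 𝔼 c').source) {η ε : ℝ} (hη : 0 < η) (hε : 0 < ε) :
    ∃ ρ > 0, ∀ w, ∀ x ∈ K, ∀ q ∈ K', dist (f w x) q < ρ → ∀ r, 0 < r → r < ρ → ∀ a ∈
      Metric.closedBall (extChartAt (𝓡 m) c x) r, a ∈ (extChartAt (𝓡 m) c).target ∧
      f w ((extChartAt (𝓡 m) c).symm a) ∈ (chartAt 𝔼 c').source ∧
      dist ((extChartAt (𝓡 m) c).symm a) x < ε ∧ ∀ b ∈ Metric.closedBall (extChartAt (𝓡 m) c x) r,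
        ‖(extChartAt (𝓡 m) c' ∘ f w ∘ (extChartAt (𝓡 m) c).symm) a -
          (extChartAt (𝓡 m) c' ∘ f w ∘ (extChartAt (𝓡 m) c).symm) b -
          coordDeriv (m := m) (f w) c c' x (a - b)‖ ≤ η * ‖a - b‖ := by
  have hfc := continuous_apply_prod hf
  -- The radius is a coordinate of the compact space, so that one compactness argument near `f w x =
  -- q`, `r = 0` bounds the jump and the radius together.
  obtain ⟨ρ, hρ, H⟩ := exists_pos_forall_of_eventually_near_zero
    ((isCompact_univ (X := Ω)).prod (hK.isCompact.prod (hK'.isCompact.prod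
      (isCompact_Icc (a := (0 : ℝ)) (b := 1)))))
    (h := fun z : Ω × M × M × ℝ => max (dist (f z.1 z.2.1) z.2.2.1) z.2.2.2)
    (((hfc.comp (by fun_prop : Continuous fun z : Ω × M × M × ℝ => (z.2.1, z.1))).dist
      (by fun_prop)).max (by fun_prop))
    (P := fun z => ∀ a ∈
      Metric.closedBall (extChartAt (𝓡 m) c z.2.1) z.2.2.2, a ∈ (extChartAt (𝓡 m) c).target ∧
      f z.1 ((extChartAt (𝓡 m) c).symm a) ∈ (chartAt 𝔼 c').source ∧
      dist ((extChartAt (𝓡 m) c).symm a) z.2.1 < ε ∧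
      ∀ b ∈ Metric.closedBall (extChartAt (𝓡 m) c z.2.1) z.2.2.2,
        ‖(extChartAt (𝓡 m) c' ∘ f z.1 ∘ (extChartAt (𝓡 m) c).symm) a -
          (extChartAt (𝓡 m) c' ∘ f z.1 ∘ (extChartAt (𝓡 m) c).symm) b -
          coordDeriv (m := m) (f z.1) c c' z.2.1 (a - b)‖ ≤ η * ‖a - b‖) (by
      rintro ⟨w₀, x₀, q₀, r₀⟩ ⟨-, hx₀, hq₀, hr₀⟩ hd
      obtain ⟨hd, hr⟩ := max_le_iff.1 hd
      obtain rfl : f w₀ x₀ = q₀ := dist_le_zero.1 hd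
      obtain rfl : r₀ = 0 := le_antisymm hr hr₀.1
      have hxs := hKs hx₀
      have hys := hKs' hq₀
      set κ := extChartAt (𝓡 m) c with hκ
      have hxe : x₀ ∈ κ.source := by simpa [hκ] using hxs
      have hsymm : ContinuousAt κ.symm (κ x₀) := continuousAt_extChartAt_symm' hxe
      have hleft : κ.symm (κ x₀) = x₀ := κ.left_inv hxe
      have hpair : ContinuousAt (fun p : Ω × 𝔼 => (κ.symm p.2, p.1)) (w₀, κ x₀) :=
        (ContinuousAt.comp (x := (w₀, κ x₀)) (f := fun p : Ω × 𝔼 => p.2) hsymm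
          continuousAt_snd).prodMk continuousAt_fst
      have e1 : ∀ᶠ p : Ω × 𝔼 in 𝓝 (w₀, κ x₀), p.2 ∈ κ.target :=
        continuousAt_snd.preimage_mem_nhds (extChartAt_target_mem_nhds' (κ.map_source hxe))
      have e2 : ∀ᶠ p : Ω × 𝔼 in 𝓝 (w₀, κ x₀), f p.1 (κ.symm p.2) ∈ (chartAt 𝔼 c').source := by
        have : ContinuousAt (fun p : Ω × 𝔼 => f p.1 (κ.symm p.2)) (w₀, κ x₀) :=
          ContinuousAt.comp (x := (w₀, κ x₀)) (f := fun p : Ω × 𝔼 => (κ.symm p.2, p.1))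
            hfc.continuousAt hpair
        exact this.preimage_mem_nhds ((chartAt 𝔼 c').open_source.mem_nhds (by simpa [hleft] using hys))
      have e3 : ∀ᶠ p : Ω × 𝔼 in 𝓝 (w₀, κ x₀), dist (κ.symm p.2) x₀ < ε / 2 := by
        have : ContinuousAt (fun p : Ω × 𝔼 => dist (κ.symm p.2) x₀) (w₀, κ x₀) :=
          (continuousAt_fst.comp hpair).dist continuousAt_const
        exact this.eventually_lt continuousAt_const (by simpa [hleft] using hε)
      have e4 : ∀ᶠ p : Ω × 𝔼 in 𝓝 (w₀, κ x₀), ‖coordDeriv (m := m) (f p.1) c c' (κ.symm p.2) -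
          coordDeriv (m := m) (f w₀) c c' x₀‖ < η / 2 := by
        have h0 : ContinuousAt (fun p : M × Ω => coordDeriv (m := m) (f p.2) c c' p.1)
            (κ.symm (κ x₀), w₀) :=
          continuousAt_coordDeriv hf (by simpa [hleft] using hxs) (by simpa [hleft] using hys)
        have := ((ContinuousAt.comp (x := (w₀, κ x₀)) (f := fun p : Ω × 𝔼 => (κ.symm p.2, p.1))
          h0 hpair).sub (continuousAt_const (y := coordDeriv (m := m) (f w₀) c c' x₀))).norm
        exact this.eventually_lt continuousAt_const (by simpa [hleft] using hη)
      have e := e1.and (e2.and (e3.and e4))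
      rw [nhds_prod_eq, Filter.eventually_prod_iff] at e
      obtain ⟨pw, hpw, pa, hpa, hp⟩ := e
      obtain ⟨ρ, hρ, hball⟩ := Metric.eventually_nhds_iff_ball.1 hpa
      have hfst : ContinuousAt (fun z : Ω × M × M × ℝ => z.1) (w₀, x₀, f w₀ x₀, 0) := continuousAt_fst
      have hx : ContinuousAt (fun z : Ω × M × M × ℝ => z.2.1) (w₀, x₀, f w₀ x₀, 0) := by fun_prop
      have hr : ContinuousAt (fun z : Ω × M × M × ℝ => z.2.2.2) (w₀, x₀, f w₀ x₀, 0) := by fun_prop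
      have hκx : ContinuousAt (fun z : Ω × M × M × ℝ => dist (κ z.2.1) (κ x₀))
          (w₀, x₀, f w₀ x₀, 0) :=
        (ContinuousAt.comp (x := (w₀, x₀, f w₀ x₀, (0 : ℝ))) (f := fun z : Ω × M × M × ℝ => z.2.1)
          (continuousAt_extChartAt' hxe) hx).dist continuousAt_const
      filter_upwards [hfst.eventually hpw, hr.eventually_lt continuousAt_const (half_pos hρ),
        hκx.eventually_lt (continuousAt_const (y := ρ / 2)) (by simpa using hρ),
        hx.preimage_mem_nhds ((chartAt 𝔼 c).open_source.mem_nhds hxs)] with ⟨w, x, q, r⟩ hw hr hκx hxs'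
      simp only at hw hr hκx
      have hxe' : x ∈ κ.source := by simpa [hκ] using hxs'
      have hxball : κ x ∈ Metric.ball (κ x₀) ρ := by
        rw [Metric.mem_ball]; linarith
      have hsub : Metric.closedBall (κ x) r ⊆ Metric.ball (κ x₀) ρ := by
        intro a ha
        rw [Metric.mem_closedBall] at ha
        rw [Metric.mem_ball]
        linarith [dist_triangle a (κ x) (κ x₀)]
      have hgood := fun a ha => hp hw (hball a ha)
      have hx₀x := (hgood _ hxball).2.2.1
      simp only [κ.left_inv hxe'] at hx₀x
      have hDx := (hgood _ hxball).2.2.2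
      simp only [κ.left_inv hxe'] at hDx
      intro a ha
      obtain ⟨ha1, ha2, ha3, -⟩ := hgood a (hsub ha)
      refine ⟨ha1, ha2, ?_, fun b hb => ?_⟩
      · have := dist_triangle_right (κ.symm a) x x₀
        simp only at ha3 ⊢
        linarith
      -- Mean value inequality on a ball: the derivatives at `κ.symm a` and at `x` are both within
      -- `η / 2` of the one at `x₀`.
      · refine Convex.norm_image_sub_le_of_norm_hasFDerivWithin_le' (𝕜 := ℝ) (s := Metric.ball (κ x₀) ρ)
          (f' := fun a => coordDeriv (m := m) (f w) c c' (κ.symm a)) (fun a ha => ?_) (fun a ha => ?_)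
          (convex_ball _ _) (hsub hb) (hsub ha)
        · obtain ⟨ha1, ha2, -⟩ := hgood a ha
          have h1 := hasFDerivAt_coord (m := m) ((f w).contMDiff.mdifferentiable (by norm_num)) (c := c)
            (c' := c') (x := κ.symm a) (by simpa [hκ] using κ.map_target ha1) ha2
          rw [← hκ, κ.right_inv ha1] at h1
          exact h1.hasFDerivWithinAt
        · have h1 := (hgood a ha).2.2.2
          simp only at h1
          rw [← sub_sub_sub_cancel_right _ _ (coordDeriv (m := m) (f w₀) c c' x₀)]
          exact (norm_sub_le _ _).trans (by linarith))
  refine ⟨min ρ 1, by positivity, fun w x hx q hq hd r hr hrρ => H (w, x, q, r)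
    ⟨mem_univ _, hx, hq, hr.le, (hrρ.trans_le (min_le_right _ _)).le⟩
    (max_lt (hd.trans_le (min_le_left _ _)) (hrρ.trans_le (min_le_left _ _)))⟩

end Charts

/-! ### Shadowing of chains in the fibers -/

section Shadowing

variable {m : ℕ} {M : Type*} [MetricSpace M] [CompactSpace M]
  [ChartedSpace (EuclideanSpace ℝ (Fin m)) M] [IsManifold (𝓡 m) ∞ M]
  {Ω : Type*} [TopologicalSpace Ω]

local notation "𝔼" => EuclideanSpace ℝ (Fin m)

/-- The shadowing lemma on fibers. -/
theorem exists_shadowing [AddCommGroup Ω] [CompactSpace Ω]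
    (g : Bundle.ContMDiffRiemannianMetric (𝓡 m) ∞ 𝔼 (fun x : M => TangentSpace (𝓡 m) x))
    {θ : Ω ≃ₜ Ω} {α : Ω} (hθ : ∀ w, θ w = w + α)
    {f : Ω → M ≃ₘ^2⟮𝓡 m, 𝓡 m⟯ M} (hf : Continuous f) (hA : IsAnosovOnFibers g θ f)
    {ε : ℝ} (hε : 0 < ε) :
    ∃ δ > 0, ∀ n w x y, Reach (fun w x => f w x) α δ n w x y →
      ∃ z, dist z x < ε ∧ dist ((skewMap (fun w x => f w x) α)^[n] (z, w)).1 y < ε := by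
  obtain ⟨lam, hlam, Eu, Es, hsp, hA⟩ := hA
  obtain ⟨t, K, ch, hKc, hKs, hch, hchK⟩ := exists_finite_closed_charts (m := m) M
  -- The bound on `1 + ‖P‖` controls both projections `P` and `1 - P`.
  have hL : ∃ L : ℝ, 1 ≤ L ∧ ∀ x, (∀ v, ‖v‖ ≤ L * coordNorm g (ch x) x v) ∧
      (∀ v, coordNorm g (ch x) x v ≤ L * ‖v‖) ∧ ∀ w, 1 + ‖coordProj hsp (ch x) x w‖ ≤ L := by
    choose B hB using fun c => exists_coord_bounds g hsp (hKc c) (hKs c)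
    have hle : ∀ x, B (ch x) ≤ 1 + ∑ c ∈ t, |B c| := fun x => by
      have := Finset.single_le_sum (f := fun c => |B c|) (fun c _ => abs_nonneg _) (hch x)
      linarith [le_abs_self (B (ch x))]
    refine ⟨1 + ∑ c ∈ t, |B c|, le_add_of_nonneg_right (Finset.sum_nonneg fun c _ => abs_nonneg _),
      fun x => ⟨fun v => ?_, fun v => ?_, fun w => ?_⟩⟩
    · exact ((hB _ x (hchK x)).1 v).trans
        (mul_le_mul_of_nonneg_right (hle x) (tangentNorm_nonneg g x _))
    · exact ((hB _ x (hchK x)).2.1 v).trans (mul_le_mul_of_nonneg_right (hle x) (norm_nonneg v))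
    · have h1 := (hB _ x (hchK x)).2.2 w
      have := Finset.single_le_sum (f := fun c => |B c|) (fun c _ => abs_nonneg _) (hch x)
      linarith [le_abs_self (B (ch x))]
  obtain ⟨L, hL1, hL⟩ := hL
  -- Half of the hyperbolic rate is kept; the other half absorbs the factor `1 + 4 * L ^ 2 * ε₁`
  -- from moving the splitting.
  set μ := Real.exp (-(lam / 2)) with hμ
  have hμ1 : μ < 1 := by rw [hμ, Real.exp_lt_one_iff]; linarith
  obtain ⟨η, hη, C, hC, hseq⟩ := exists_shadowing_seq (E := 𝔼) hL1 (Real.exp_pos _).le hμ1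
  obtain ⟨ε₁, hε₁, hε₁L, hε₁1, hε₁η, hε₁μ⟩ : ∃ ε₁ > 0, 2 * L * ε₁ ≤ 1 ∧ ε₁ ≤ 1 ∧
      2 * L ^ 2 * ε₁ ≤ η ∧ 1 + 4 * L ^ 2 * ε₁ ≤ Real.exp (lam / 2) := by
    have h1 : 0 < Real.exp (lam / 2) - 1 := by
      have := Real.add_one_lt_exp (x := lam / 2) (by positivity)
      linarith
    have h2 : ∀ c : ℝ, 0 < c → ∀ b > 0, ∀ᶠ e in 𝓝[>] (0 : ℝ), c * e ≤ b := by
      intro c hc b hb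
      filter_upwards [Ioo_mem_nhdsGT (show (0 : ℝ) < b / c by positivity)] with e he
      have := he.2
      rw [lt_div_iff₀ hc] at this
      linarith
    have hev := (((h2 (2 * L) (by positivity) 1 one_pos).and (h2 1 one_pos 1 one_pos)).and
      ((h2 (2 * L ^ 2) (by positivity) η hη).and (h2 (4 * L ^ 2) (by positivity) _ h1))).and
      self_mem_nhdsWithin
    obtain ⟨e, ⟨⟨e1, e2⟩, e3, e4⟩, e5⟩ := hev.exists
    exact ⟨e, e5, e1, by linarith, e3, by linarith⟩
  have hε₁η' : ε₁ ≤ η := hε₁η.trans' (le_mul_of_one_le_left hε₁.le (by nlinarith))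
  obtain ⟨ρ, hρ, hρapprox⟩ := exists_pos_forall_finset (t ×ˢ t) (fun cc ρ => ∀ w, ∀ x ∈ K cc.1,
      ∀ q ∈ K cc.2, dist (f w x) q < ρ → ∀ r, 0 < r → r < ρ → ∀ a ∈
      Metric.closedBall (extChartAt (𝓡 m) cc.1 x) r, a ∈ (extChartAt (𝓡 m) cc.1).target ∧
      f w ((extChartAt (𝓡 m) cc.1).symm a) ∈ (chartAt 𝔼 cc.2).source ∧
      dist ((extChartAt (𝓡 m) cc.1).symm a) x < ε ∧
      ∀ b ∈ Metric.closedBall (extChartAt (𝓡 m) cc.1 x) r,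
        ‖(extChartAt (𝓡 m) cc.2 ∘ f w ∘ (extChartAt (𝓡 m) cc.1).symm) a -
          (extChartAt (𝓡 m) cc.2 ∘ f w ∘ (extChartAt (𝓡 m) cc.1).symm) b -
          coordDeriv (m := m) (f w) cc.1 cc.2 x (a - b)‖ ≤ η * ‖a - b‖)
    (fun cc δ δ' hδ h w x hx q hq hd r hr hrδ => h w x hx q hq (hd.trans_le hδ) r hr (hrδ.trans_le hδ))
    (fun cc _ => exists_coord_approx hf (hKc _) (hKs _) (hKc _) (hKs _) hη hε)
  -- This radius is independent of the chain. The jump size `δ` is then chosen so that the initial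
  -- defect in coordinates is at most `r / C`.
  set r := ρ / 2 with hr
  have hr0 : 0 < r := by positivity
  obtain ⟨δ, hδ, hclose⟩ := exists_pos_forall_finset t (fun c δ => ∀ q ∈ K c, ∀ y, dist y q < δ →
      y ∈ (chartAt 𝔼 c).source ∧
      ‖extChartAt (𝓡 m) c y - extChartAt (𝓡 m) c q‖ ≤ min ε₁ (r / C) ∧
      (∀ v, |coordNorm g c y v - coordNorm g c q v| ≤ min ε₁ (r / C) * ‖v‖) ∧
      ∀ w, ‖coordProj hsp c y w - coordProj hsp c q w‖ ≤ min ε₁ (r / C))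
    (fun c δ δ' hδ h q hq y hd => h q hq y (hd.trans_le hδ))
    (fun c _ => exists_coord_close g hsp (hKc c) (hKs c) (by positivity))
  refine ⟨min δ ρ, by positivity, fun n w x y hxy => ?_⟩
  obtain ⟨p, hp0, hpn, hp⟩ := hxy.exists_seq
  let v : ℕ → Ω := fun j => w + j • α
  have hv : ∀ j, θ (v j) = v (j + 1) := fun j => by
    simp only [v]
    rw [hθ, succ_nsmul, add_assoc]
  have hxs : ∀ j, p j ∈ (chartAt 𝔼 (ch (p j))).source := fun j => hKs _ (hchK (p j))
  have hpρ : ∀ j < n, dist (f (v j) (p j)) (p (j + 1)) < ρ := fun j hj =>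
    (hp j hj).trans_le (min_le_right _ _)
  have happ := fun j hj => hρapprox (ch (p j), ch (p (j + 1)))
    (Finset.mk_mem_product (hch _) (hch _)) (v j) (p j) (hchK _) (p (j + 1)) (hchK _) (hpρ j hj) r hr0
    (half_lt_self hρ)
  have hcl := fun j hj => hclose (ch (p (j + 1))) (hch _) (p (j + 1)) (hchK _) (f (v j) (p j))
    ((hp j hj).trans_le (min_le_left _ _))
  have hP : ∀ x w (b : 𝔼), ‖coordProj hsp (ch x) x w b‖ ≤ L * ‖b‖ ∧
      ‖b - coordProj hsp (ch x) x w b‖ ≤ L * ‖b‖ := fun x w b => by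
    have h1 := (hL x).2.2 w
    have h2 := (coordProj hsp (ch x) x w).le_opNorm b
    have h3 := norm_sub_le b (coordProj hsp (ch x) x w b)
    have h4 := norm_nonneg b
    constructor <;> nlinarith
  have hDmap : ∀ j < n, ∀ b : 𝔼, ofCoord (ch (p (j + 1))) (f (v j) (p j))
      (coordDeriv (m := m) (f (v j)) (ch (p j)) (ch (p (j + 1))) (p j) b) =
      mfderiv (𝓡 m) (𝓡 m) (f (v j)) (p j) (ofCoord (ch (p j)) (p j) b) := fun j hj b =>
    ofCoord_coordAt (hcl j hj).1 _
  have hexp : Real.exp (-lam) * Real.exp (lam / 2) = μ := by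
    rw [← Real.exp_add, hμ]
    ring_nf
  have hexp1 : Real.exp (-lam) ≤ 1 := Real.exp_le_one_iff.2 (by linarith)
  obtain ⟨z, hzb, hz⟩ := hseq r hr0 n (fun j => extChartAt (𝓡 m) (ch (p j)) (p j))
    (fun j => extChartAt (𝓡 m) (ch (p (j + 1))) ∘ f (v j) ∘ (extChartAt (𝓡 m) (ch (p j))).symm)
    (fun j => coordDeriv (m := m) (f (v j)) (ch (p j)) (ch (p (j + 1))) (p j))
    (fun j => coordNorm g (ch (p j)) (p j))
    (fun j => (Es (p j) (v j)).comap (ofCoord (ch (p j)) (p j)).toLinearMap)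
    (fun j => (Eu (p j) (v j)).comap (ofCoord (ch (p j)) (p j)).toLinearMap)
    (fun j => (hL (p j)).1) (fun j => (hL (p j)).2.1) (fun j => coordNorm_add_le g _ _)
    (fun j b => ⟨b - coordProj hsp (ch (p j)) (p j) (v j) b, sub_coordProj_mem hsp (hxs j) _ _,
      coordProj hsp (ch (p j)) (p j) (v j) b, coordProj_mem hsp (hxs j) _ _, sub_add_cancel _ _,
      (hP _ _ b).2, (hP _ _ b).1⟩)
    (fun j hj b hb => by
      obtain ⟨h1, -, h3, h4⟩ := hcl j hj
      set Db := coordDeriv (m := m) (f (v j)) (ch (p j)) (ch (p (j + 1))) (p j) b with hDb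
      have hmem : ofCoord (ch (p (j + 1))) (f (v j) (p j)) Db ∈ Es (f (v j) (p j)) (v (j + 1)) := by
        rw [hDb, hDmap j hj, ← hv, ← (hA (p j) (v j)).2.2.1]
        exact Submodule.mem_map_of_mem hb
      have hcontr : coordNorm g (ch (p (j + 1))) (f (v j) (p j)) Db ≤
          Real.exp (-lam) * coordNorm g (ch (p j)) (p j) b := by
        rw [coordNorm, hDb, hDmap j hj]
        exact (hA (p j) (v j)).2.2.2.2 _ hb
      obtain ⟨ha, hb'⟩ := stable_correction hL1 hε₁.le hε₁L (hL (p (j + 1))).1 (hL (p (j + 1))).2.1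
        (coordNorm_add_le g _ _)
        (fun b => (h3 b).trans (mul_le_mul_of_nonneg_right (min_le_left _ _) (norm_nonneg b)))
        ((h4 (v (j + 1))).trans (min_le_left _ _)) (coordProj_eq_zero hsp hmem)
      have hNb : 0 ≤ coordNorm g (ch (p j)) (p j) b := tangentNorm_nonneg _ _ _
      have hN2 : coordNorm g (ch (p (j + 1))) (f (v j) (p j)) Db ≤ L * ‖b‖ :=
        (hcontr.trans (mul_le_of_le_one_left hNb hexp1)).trans ((hL (p j)).2.1 b)
      refine ⟨Db - coordProj hsp (ch (p (j + 1))) (p (j + 1)) (v (j + 1)) Db,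
        sub_coordProj_mem hsp (hxs _) _ _, ?_, ?_⟩
      · rw [sub_sub_cancel_left, norm_neg]
        calc _ ≤ 2 * L * ε₁ * (L * ‖b‖) := ha.trans (by gcongr)
          _ = 2 * L ^ 2 * ε₁ * ‖b‖ := by ring
          _ ≤ η * ‖b‖ := by gcongr
      · calc _ ≤ Real.exp (lam / 2) * (Real.exp (-lam) * coordNorm g (ch (p j)) (p j) b) :=
              hb'.trans (mul_le_mul hε₁μ hcontr (tangentNorm_nonneg _ _ _) (Real.exp_pos _).le)
          _ = μ * coordNorm g (ch (p j)) (p j) b := by rw [← hexp]; ring)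
    (fun j hj b hb => by
      obtain ⟨h1, -, h3, h4⟩ := hcl j hj
      obtain ⟨ha, hb'⟩ := unstable_correction hL1 hε₁.le hε₁1 (hL (p (j + 1))).1
        (hL (p (j + 1))).2.1 (coordNorm_add_le g _ _)
        (fun b => (h3 b).trans (mul_le_mul_of_nonneg_right (min_le_left _ _) (norm_nonneg b)))
        ((h4 (v (j + 1))).trans (min_le_left _ _)) (coordProj_eq_self hsp (hxs (j + 1)) hb)
      -- The projection of `b` is unstable at the image point, so invariance of `Eu` gives a
      -- preimage `ξ` under the derivative, and expansion bounds it.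
      have hmem := coordProj_mem hsp h1 (v (j + 1)) b
      rw [← hv, ← (hA (p j) (v j)).2.1] at hmem
      obtain ⟨ξ, hξ, hξb⟩ := hmem
      have hξc : ofCoord (ch (p j)) (p j) (coordAt (ch (p j)) (p j) ξ) = ξ := ofCoord_coordAt (hxs j) ξ
      have hD : coordDeriv (m := m) (f (v j)) (ch (p j)) (ch (p (j + 1))) (p j)
          (coordAt (ch (p j)) (p j) ξ) =
          coordProj hsp (ch (p (j + 1))) (f (v j) (p j)) (v (j + 1)) b := by
        rw [← coordAt_ofCoord h1 (coordProj hsp (ch (p (j + 1))) (f (v j) (p j)) (v (j + 1)) b),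
          ← hv, ← hξb, ← coordAt_ofCoord h1 (coordDeriv _ _ _ _ _), hDmap j hj, hξc]
        rfl
      refine ⟨coordAt (ch (p j)) (p j) ξ, by simpa [hξc] using hξ, ?_, ?_⟩
      · rw [hD]
        exact ha.trans (by gcongr)
      · have hexpand := (hA (p j) (v j)).2.2.2.1 ξ hξ
        have hN : coordNorm g (ch (p (j + 1))) (f (v j) (p j))
            (coordProj hsp (ch (p (j + 1))) (f (v j) (p j)) (v (j + 1)) b) =
            tangentNorm g (f (v j) (p j)) (mfderiv (𝓡 m) (𝓡 m) (f (v j)) (p j) ξ) := by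
          rw [coordNorm, ← hv, ← hξb]
          rfl
        have hξN : coordNorm g (ch (p j)) (p j) (coordAt (ch (p j)) (p j) ξ) = tangentNorm g (p j) ξ := by
          rw [coordNorm, hξc]
        rw [hξN]
        rw [hN] at hb'
        have h5 : tangentNorm g (p j) ξ ≤ Real.exp (-lam) *
            tangentNorm g (f (v j) (p j)) (mfderiv (𝓡 m) (𝓡 m) (f (v j)) (p j) ξ) := by
          rw [Real.exp_neg, le_inv_mul_iff₀ (Real.exp_pos _)]
          exact hexpand
        have hNb : 0 ≤ coordNorm g (ch (p (j + 1))) (p (j + 1)) b := tangentNorm_nonneg _ _ _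
        calc _ ≤ Real.exp (-lam) * (Real.exp (lam / 2) * coordNorm g (ch (p (j + 1))) (p (j + 1)) b) :=
              h5.trans (by
                gcongr
                exact hb'.trans (by gcongr))
          _ = μ * coordNorm g (ch (p (j + 1))) (p (j + 1)) b := by rw [← hexp]; ring)
    (fun j hj a ha b hb => ((happ j hj a ha).2.2.2 b hb))
    (fun j hj => by
      have := (hcl j hj).2.1.trans (min_le_right _ _)
      simpa [(chartAt 𝔼 (ch (p j))).left_inv (hxs j)] using this)
  -- The last point has no successor in the chain; taking its exact image under `f w` as target
  -- makes the estimate available at every index, `n` included.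
  have hball : ∀ j, ∀ a ∈ Metric.closedBall (extChartAt (𝓡 m) (ch (p j)) (p j)) r,
      a ∈ (extChartAt (𝓡 m) (ch (p j))).target ∧
      dist ((extChartAt (𝓡 m) (ch (p j))).symm a) (p j) < ε := fun j a ha => by
    obtain ⟨h1, -, h2, -⟩ := hρapprox (ch (p j), ch (f w (p j)))
      (Finset.mk_mem_product (hch _) (hch _)) w (p j) (hchK _) (f w (p j)) (hchK _)
      (by simpa using hρ) r hr0 (half_lt_self hρ) a ha
    exact ⟨h1, h2⟩
  let Z : ℕ → M := fun j => (extChartAt (𝓡 m) (ch (p j))).symm (z j)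
  have hZ : ∀ j < n, f (v j) (Z j) = Z (j + 1) := fun j hj => by
    have h1 := (happ j hj (z j) (hzb j hj.le)).2.1
    have h2 := hz j hj
    simp only [Function.comp_apply] at h2
    simp only [Z]
    rw [← h2]
    exact ((extChartAt (𝓡 m) (ch (p (j + 1)))).left_inv
      (by simpa only [extChartAt_source] using h1)).symm
  have horbit : ∀ j ≤ n, (skewMap (fun w x => f w x) α)^[j] (Z 0, w) = (Z j, v j) := fun j => by
    induction j with
    | zero => simp [v]
    | succ j ih =>
      intro hj
      rw [Function.iterate_succ_apply', ih (by omega), skewMap]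
      simp only [hZ j (by omega), ← hv, hθ]
  refine ⟨Z 0, hp0 ▸ (hball 0 _ (hzb 0 (Nat.zero_le n))).2, ?_⟩
  rw [horbit n le_rfl, ← hpn]
  exact (hball n _ (hzb n le_rfl)).2

end Shadowing

/-! ### Transitive permutations of a finite set -/

section Permutation

/-- The conditions force `τ i = (σ ^ i) 0`. The orbit of `0` is everything, so this is a bijection,
and it closes up because powers of `σ` at `0` depend only on the exponent modulo `k`. -/
theorem cyclic_enumeration {k : ℕ} [NeZero k] (σ : Equiv.Perm (Fin k))
    (hσ : ∀ i, ∃ n : ℤ, (σ ^ n) 0 = i) :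
    ∃! τ : Equiv.Perm (Fin k), τ 0 = 0 ∧ ∀ i, σ (τ i) = τ (i + 1) := by
  have hcyc : σ.IsCycleOn ((Finset.univ : Finset (Fin k)) : Set (Fin k)) := by
    refine ⟨by simp, fun x _ y _ => ?_⟩
    obtain ⟨a, rfl⟩ := hσ x
    obtain ⟨b, rfl⟩ := hσ y
    exact ⟨b - a, by rw [← Equiv.Perm.mul_apply, ← zpow_add, sub_add_cancel]⟩
  have hsurj : Function.Surjective fun i : Fin k => (σ ^ (i : ℕ)) 0 := fun j => by
    obtain ⟨n, hn, h⟩ := hcyc.exists_pow_eq (Finset.mem_univ 0) (Finset.mem_univ j)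
    exact ⟨⟨n, by simpa using hn⟩, h⟩
  have hval : ∀ i : Fin k, ((i + 1 : Fin k) : ℕ) ≡ i + 1 [MOD k] := fun i => by
    rw [Fin.val_add, Fin.val_one', Nat.add_mod_mod]
    exact Nat.mod_modEq _ _
  refine ⟨Equiv.ofBijective _ (Finite.surjective_iff_bijective.1 hsurj), ⟨by simp, fun i => ?_⟩, ?_⟩
  · simp only [Equiv.ofBijective_apply]
    rw [← Equiv.Perm.mul_apply, ← pow_succ', hcyc.pow_apply_eq_pow_apply (Finset.mem_univ 0)]
    simpa using (hval i).symm
  · rintro τ ⟨h0, hτ⟩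
    ext1 i
    simp only [Equiv.ofBijective_apply]
    have : ∀ n (hn : n < k), τ ⟨n, hn⟩ = (σ ^ n) 0 := by
      intro n
      induction n with
      | zero => exact fun hn => h0
      | succ n ih =>
        intro hn
        rw [pow_succ', Equiv.Perm.mul_apply, ← ih (by omega), hτ]
        congr 1
        ext
        rw [Fin.val_add, Fin.val_one', Nat.add_mod_mod, Nat.mod_eq_of_lt hn]
    exact this i i.2

theorem pow_card_of_transitive {k : ℕ} {β : Type*} (C : Fin k ≃ β) (s : Equiv.Perm β) (c₀ : β)
    (hs : ∀ c, ∃ n : ℤ, (s ^ n) c₀ = c) (c : β) (n : ℕ) : (s ^ n) c = c ↔ k ∣ n := by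
  classical
  have : Fintype β := Fintype.ofEquiv _ C
  have hcyc : s.IsCycleOn ((Finset.univ : Finset β) : Set β) := by
    refine ⟨by simp, fun x _ y _ => ?_⟩
    obtain ⟨a, rfl⟩ := hs x
    obtain ⟨b, rfl⟩ := hs y
    exact ⟨b - a, by rw [← Equiv.Perm.mul_apply, ← zpow_add, sub_add_cancel]⟩
  rw [hcyc.pow_apply_eq (Finset.mem_univ c), Finset.card_univ, ← Fintype.card_congr C,
    Fintype.card_fin]

end Permutation

/-! ### From a dense two-sided orbit to positive transitivity -/

section Transitive

variable {Y : Type*} [TopologicalSpace Y]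

theorem continuous_zpow_of_continuous {φ : Equiv.Perm Y} (h : Continuous φ)
    (h' : Continuous φ.symm) (n : ℤ) : Continuous ⇑(φ ^ n) := by
  cases n with
  | ofNat n =>
    rw [Int.ofNat_eq_natCast, zpow_natCast, Equiv.Perm.coe_pow]
    exact h.iterate n
  | negSucc n =>
    rw [zpow_negSucc, ← inv_pow, Equiv.Perm.coe_pow]
    exact Continuous.iterate h' _

/-- In a space without isolated points, a homeomorphism with a dense orbit moves every open set
into every open set by positive iterates. -/
theorem IsTransitive.isPositivelyTransitive [T1Space Y] [∀ y : Y, (𝓝[≠] y).NeBot]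
    {φ : Equiv.Perm Y} (hφ : IsTransitive φ) (h : Continuous φ) (h' : Continuous φ.symm) :
    IsPositivelyTransitive φ := by
  obtain ⟨p, hp⟩ := hφ
  intro A B hA hB hA0 hB0
  obtain ⟨_, hi, i, rfl⟩ := hp.inter_open_nonempty A hA hA0
  obtain ⟨_, hj, j, rfl⟩ := hp.inter_open_nonempty B hB hB0
  -- When the orbit is in `W` at time `t`, it is in `B` at time `t` and in `A` at time `t + (i -
  -- j)`. Without isolated points such visits are infinitely many.
  set W := B ∩ ⇑(φ ^ (i - j)) ⁻¹' A with hW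
  have hWo : IsOpen W := hB.inter (hA.preimage (continuous_zpow_of_continuous h h' _))
  have hWne : W.Nonempty := ⟨(φ ^ j) p, hj, by
    rw [mem_preimage, ← Equiv.Perm.mul_apply, ← zpow_add, sub_add_cancel]
    exact hi⟩
  set T : Set ℤ := {t | (φ ^ t) p ∈ W} with hT
  have hTinf : T.Infinite := by
    intro hfin
    obtain ⟨_, hx, ⟨t, rfl⟩, ht⟩ := (hp.sdiff_finite (hfin.image fun t => (φ ^ t) p)).inter_open_nonempty
      W hWo hWne
    exact ht ⟨t, hx, rfl⟩
  -- The visits may be unbounded in only one direction of time. If no pair worked, comparing with a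
  -- fixed `t₀` in both roles would confine `T` to a bounded interval.
  obtain ⟨t₁, ht₁, t₂, ht₂, hlt⟩ : ∃ t₁ ∈ T, ∃ t₂ ∈ T, t₁ + (i - j) < t₂ := by
    by_contra! hcon
    obtain ⟨t₀, ht₀⟩ := hTinf.nonempty
    exact hTinf ((finite_Icc (t₀ - (i - j)) (t₀ + (i - j))).subset fun t ht =>
      ⟨by linarith [hcon t ht t₀ ht₀], by linarith [hcon t₀ ht₀ t ht]⟩)
  obtain ⟨n, hn⟩ := Int.eq_ofNat_of_zero_le (show 0 ≤ t₂ - (t₁ + (i - j)) - 1 by omega)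
  refine ⟨n, (φ ^ (t₁ + (i - j))) p, ?_, ?_⟩
  · rw [add_comm, zpow_add, Equiv.Perm.mul_apply]
    exact ht₁.2
  · rw [Equiv.Perm.iterate_eq_pow, ← Equiv.Perm.mul_apply, ← zpow_natCast, ← zpow_add]
    have : ((n + 1 : ℕ) : ℤ) + (t₁ + (i - j)) = t₂ := by push_cast; omega
    rw [this]
    exact ht₂.1

/-- An isolated point would project, the projection being open, to an isolated point of the
connected space `Ω`. -/
theorem neBot_nhdsNE_prod {X Ω : Type*} [TopologicalSpace X] [TopologicalSpace Ω]
    [ConnectedSpace Ω] [Nontrivial Ω] [T1Space Ω] [T1Space X] (p : X × Ω) : (𝓝[≠] p).NeBot := by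
  have := ConnectedSpace.neBot_nhdsWithin_compl_of_nontrivial_of_t1space p.2
  refine ⟨fun hbot => this.ne ?_⟩
  rw [← isOpen_singleton_iff_punctured_nhds] at hbot ⊢
  simpa using isOpenMap_snd _ hbot

end Transitive

/-! ### The permutation of the connected components -/

section Components

variable {m : ℕ} {M : Type*} [TopologicalSpace M]
  [ChartedSpace (EuclideanSpace ℝ (Fin m)) M] [IsManifold (𝓡 m) ∞ M]
  {Ω : Type*}

/-- Local connectedness makes the space of components discrete, so a continuous map to it from the
connected space `Ω` is constant. -/
theorem exists_component_perm [LocallyConnectedSpace M] [TopologicalSpace Ω] [PreconnectedSpace Ω]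
    [Nonempty Ω]
    {f : Ω → M ≃ₘ^2⟮𝓡 m, 𝓡 m⟯ M} (hf : Continuous f) :
    ∃ s : Equiv.Perm (ConnectedComponents M), ∀ w x,
      ConnectedComponents.mk (f w x) = s (ConnectedComponents.mk x) := by
  obtain ⟨w₀⟩ := ‹Nonempty Ω›
  have hconst : ∀ w x, ConnectedComponents.mk (f w x) = ConnectedComponents.mk (f w₀ x) := fun w x =>
    PreconnectedSpace.constant (α := Ω) (f := fun w => ConnectedComponents.mk (f w x)) inferInstance
      (ConnectedComponents.continuous_coe.comp
        ((continuous_apply_prod hf).comp (Continuous.prodMk_right x)))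
  let u := (f w₀).continuous.connectedComponentsMap
  have hu : ∀ x, u (ConnectedComponents.mk x) = ConnectedComponents.mk (f w₀ x) := fun x => rfl
  let u' := (f w₀).symm.continuous.connectedComponentsMap
  have hu' : ∀ x, u' (ConnectedComponents.mk x) = ConnectedComponents.mk ((f w₀).symm x) :=
    fun x => rfl
  refine ⟨⟨u, u', fun c => ?_, fun c => ?_⟩, fun w x => (hconst w x).trans (hu x).symm⟩
  · obtain ⟨x, rfl⟩ := ConnectedComponents.surjective_coe c
    rw [hu, hu', Diffeomorph.symm_apply_apply]
  · obtain ⟨x, rfl⟩ := ConnectedComponents.surjective_coe c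
    rw [hu', hu, Diffeomorph.apply_symm_apply]

theorem zpow_component {φ : Equiv.Perm (M × Ω)} {s : Equiv.Perm (ConnectedComponents M)}
    (hs : ∀ p, ConnectedComponents.mk (φ p).1 = s (ConnectedComponents.mk p.1)) (n : ℤ) (p : M × Ω) :
    ConnectedComponents.mk ((φ ^ n) p).1 = (s ^ n) (ConnectedComponents.mk p.1) := by
  have hpow : ∀ (n : ℕ) p, ConnectedComponents.mk ((φ ^ n) p).1 =
      (s ^ n) (ConnectedComponents.mk p.1) := fun n => by
    induction n with
    | zero => exact fun p => rfl
    | succ n ih =>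
      intro p
      rw [pow_succ, Equiv.Perm.mul_apply, ih, hs, pow_succ, Equiv.Perm.mul_apply]
  cases n with
  | ofNat n => exact hpow n p
  | negSucc n =>
    rw [zpow_negSucc, zpow_negSucc, Equiv.Perm.eq_inv_iff_eq, ← hpow,
      ← Equiv.Perm.mul_apply, mul_inv_cancel, Equiv.Perm.one_apply]

theorem image_componentSet {ψ : Equiv.Perm (M × Ω)} {s : Equiv.Perm (ConnectedComponents M)}
    (hs : ∀ p, ConnectedComponents.mk (ψ p).1 = s (ConnectedComponents.mk p.1))
    (c : ConnectedComponents M) :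
    ψ '' (componentSet c ×ˢ univ) = componentSet (s c) ×ˢ univ := by
  ext p
  constructor
  · rintro ⟨q, ⟨rfl, -⟩, rfl⟩
    exact ⟨hs q, mem_univ _⟩
  · rintro ⟨hp, -⟩
    refine ⟨ψ.symm p, ⟨s.injective ?_, mem_univ _⟩, ψ.apply_symm_apply p⟩
    rw [← hs, Equiv.apply_symm_apply]
    exact hp

theorem componentSet_prod_injective [Nonempty Ω] {c c' : ConnectedComponents M} :
    componentSet c ×ˢ (univ : Set Ω) = componentSet c' ×ˢ univ ↔ c = c' := by
  refine ⟨fun h => ?_, fun h => by rw [h]⟩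
  obtain ⟨w⟩ := ‹Nonempty Ω›
  obtain ⟨x, rfl⟩ := ConnectedComponents.surjective_coe c
  have : (x, w) ∈ componentSet c' ×ˢ (univ : Set Ω) := h ▸ ⟨rfl, mem_univ _⟩
  exact this.1

theorem isOpen_componentSet {M : Type*} [TopologicalSpace M] [LocallyConnectedSpace M]
    (c : ConnectedComponents M) : IsOpen (componentSet c) :=
  (isOpen_discrete {c}).preimage ConnectedComponents.continuous_coe

theorem isClosed_componentSet {M : Type*} [TopologicalSpace M] [LocallyConnectedSpace M]
    (c : ConnectedComponents M) : IsClosed (componentSet c) :=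
  (isClosed_discrete {c}).preimage ConnectedComponents.continuous_coe

theorem isPreconnected_componentSet {M : Type*} [TopologicalSpace M]
    (c : ConnectedComponents M) : IsPreconnected (componentSet c) := by
  obtain ⟨x, rfl⟩ := ConnectedComponents.surjective_coe c
  have : componentSet (ConnectedComponents.mk x) = connectedComponent x :=
    connectedComponents_preimage_singleton
  rw [this]
  exact isPreconnected_connectedComponent

end Components

/-! ### Chain mixing on one component -/

section Mixing

theorem Reach.map {X X' Ω : Type*} [MetricSpace X] [MetricSpace X'] [AddCommGroup Ω]
    {F : Ω → X → X} {G : Ω → X' → X'} {a : Ω} {δ : ℝ} (e : X → X') (he : Isometry e)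
    (h : ∀ w x, e (F w x) = G w (e x)) {n : ℕ} {w : Ω} {x y : X} (hr : Reach F a δ n w x y) :
    Reach G a δ n w (e x) (e y) := by
  induction n generalizing w x with
  | zero => exact congrArg e hr
  | succ n ih =>
    obtain ⟨z, hz, hr⟩ := hr
    exact ⟨e z, by rwa [← h, he.dist_eq], ih hr⟩

/-- Chain mixing of the `k`-th iterate on an invariant component. -/
theorem exists_forall_reach_component {M Ω : Type*} [MetricSpace M] [CompactSpace M]
    [LocallyConnectedSpace M] [TopologicalSpace Ω] [AddCommGroup Ω] [IsTopologicalAddGroup Ω]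
    [CompactSpace Ω] {φ : Equiv.Perm (M × Ω)} {a : Ω} (hφ : Continuous φ)
    (hφa : ∀ p, (φ p).2 = p.2 + a) (ht : IsPositivelyTransitive φ)
    {s : Equiv.Perm (ConnectedComponents M)}
    (hs : ∀ p, ConnectedComponents.mk (φ p).1 = s (ConnectedComponents.mk p.1)) {k : ℕ}
    {c : ConnectedComponents M} (hk : ∀ n : ℕ, (s ^ n) c = c ↔ k ∣ n) {δ : ℝ} (hδ : 0 < δ) :
    ∃ N : ℕ, ∀ n ≥ N, ∀ w, ∀ x ∈ componentSet c, ∀ y ∈ componentSet c,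
      Reach (fun w x => ((φ ^ k) (x, w)).1) (k • a) δ n w x y := by
  have hsnd : ∀ (n : ℕ) p, ((φ ^ n) p).2 = p.2 + n • a := fun n => by
    induction n with
    | zero => simp
    | succ n ih =>
      intro p
      rw [pow_succ, Equiv.Perm.mul_apply, ih, hφa, succ_nsmul]
      abel
  have hsk : (s ^ k) c = c := (hk k).2 dvd_rfl
  have hcomp : ∀ (n : ℕ) p, ConnectedComponents.mk ((φ ^ n) p).1 =
      (s ^ n) (ConnectedComponents.mk p.1) := fun n p => by
    simpa using zpow_component hs n p
  have hmem : ∀ w, ∀ x ∈ componentSet c, ((φ ^ k) (x, w)).1 ∈ componentSet c := fun w x hx => by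
    have hx' : ConnectedComponents.mk x = c := hx
    change ConnectedComponents.mk _ = c
    rw [hcomp, hx', hsk]
  let F : Ω → componentSet c → componentSet c := fun w x => ⟨((φ ^ k) (x, w)).1, hmem w x x.2⟩
  have : CompactSpace (componentSet c) :=
    isCompact_iff_compactSpace.1 (isClosed_componentSet c).isCompact
  have : PreconnectedSpace (componentSet c) :=
    isPreconnected_iff_preconnectedSpace.1 (isPreconnected_componentSet c)
  have hFc : Continuous fun p : componentSet c × Ω => F p.2 p.1 := by
    refine Continuous.subtype_mk (continuous_fst.comp (Continuous.comp ?_ (by fun_prop :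
      Continuous fun p : componentSet c × Ω => ((p.1 : M), p.2)))) _
    rw [Equiv.Perm.coe_pow]
    exact hφ.iterate k
  have hFs : ∀ w, Function.Surjective (F w) := fun w y => by
    obtain ⟨⟨x, w'⟩, hx⟩ := (φ ^ k).surjective ((y : M), w + k • a)
    have hw : w' = w := by
      have := hsnd k (x, w')
      rw [hx] at this
      simpa using this.symm
    subst hw
    have hxc : x ∈ componentSet c := by
      have := hcomp k (x, w')
      rw [hx] at this
      have hy : ConnectedComponents.mk (y : M) = c := y.2
      simp only [hy] at this
      exact (s ^ k).injective (this.symm.trans hsk.symm)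
    exact ⟨⟨x, hxc⟩, Subtype.ext (by simp only [F, hx])⟩
  let e : componentSet c × Ω → M × Ω := fun p => ((p.1 : M), p.2)
  have he : Function.Semiconj e (skewMap F (k • a)) ⇑(φ ^ k) := fun p =>
    Prod.ext rfl (hsnd k (e p)).symm
  have heo : IsOpenMap e := (isOpen_componentSet c).isOpenMap_subtype_val.prodMap IsOpenMap.id
  have hinj : Function.Injective e := Subtype.val_injective.prodMap Function.injective_id
  have htF : IsPositivelyTransitive (skewMap F (k • a)) := by
    intro A B hA hB hA0 hB0
    obtain ⟨n, _, ⟨q, hq, rfl⟩, hn⟩ := ht (e '' A) (e '' B) (heo _ hA) (heo _ hB) (hA0.image e)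
      (hB0.image e)
    obtain ⟨q', hq', hqq'⟩ := hn
    rw [Equiv.Perm.iterate_eq_pow] at hqq'
    -- Any time at which the orbit is back in the component is a multiple of `k`, so transitivity of
    -- `φ` is inherited by `φ ^ k` on the component.
    have hdvd : k ∣ n + 1 := by
      rw [← hk]
      have h1 := hcomp (n + 1) (e q)
      rw [← hqq'] at h1
      have h2 : ConnectedComponents.mk (e q').1 = c := q'.1.2
      have h3 : ConnectedComponents.mk (e q).1 = c := q.1.2
      rw [h2, h3] at h1
      exact h1.symm
    obtain ⟨l, hl⟩ := hdvd
    obtain ⟨l, rfl⟩ : ∃ l', l = l' + 1 := ⟨l - 1, by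
      rcases l with _ | l
      · omega
      · rfl⟩
    refine ⟨l, q, hq, ?_⟩
    have h4 := (he.iterate_right (l + 1)) q
    rw [Equiv.Perm.iterate_eq_pow, ← pow_mul, ← hl, ← hqq'] at h4
    rwa [hinj h4]
  obtain ⟨N, hN⟩ := exists_forall_reach hFc hFs htF hδ
  exact ⟨N, fun n hn w x hx y hy =>
    (hN n hn w ⟨x, hx⟩ ⟨y, hy⟩).map Subtype.val isometry_subtype_coe fun w x => rfl⟩

end Mixing

/-! ### The spectral decomposition -/

section Main

variable {m : ℕ} {M : Type*} [MetricSpace M] [CompactSpace M]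
  [ChartedSpace (EuclideanSpace ℝ (Fin m)) M] [IsManifold (𝓡 m) ∞ M]
  {Ω : Type*} [TopologicalSpace Ω]

/-- Spectral decomposition over a rotation of a nontrivial connected compact group. -/
theorem spectral_decomposition [AddCommGroup Ω] [IsTopologicalAddGroup Ω] [CompactSpace Ω]
    [T2Space Ω] [ConnectedSpace Ω] [Nontrivial Ω]
    (g : Bundle.ContMDiffRiemannianMetric (𝓡 m) ∞ (EuclideanSpace ℝ (Fin m))
      (fun x : M => TangentSpace (𝓡 m) x))
    {θ : Ω ≃ₜ Ω} {α : Ω} (hθ : ∀ w, θ w = w + α)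
    {f : Ω → M ≃ₘ^2⟮𝓡 m, 𝓡 m⟯ M} (hf : Continuous f)
    (htrans : IsTransitive (skewProduct θ f)) (hA : IsAnosovOnFibers g θ f) :
    Finite (ConnectedComponents M) ∧
    ∀ (k : ℕ) [NeZero k] (C : Fin k ≃ ConnectedComponents M),
      (∃! τ : Equiv.Perm (Fin k), τ 0 = 0 ∧
        ∀ i : Fin k, skewProduct θ f '' (componentSet (C (τ i)) ×ˢ univ) =
          componentSet (C (τ (i + 1))) ×ˢ univ) ∧
      ∀ i : Fin k,
        (skewProduct θ f ^ k) '' (componentSet (C i) ×ˢ univ) = componentSet (C i) ×ˢ univ ∧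
        IsMixingOnFibers (componentSet (C i)) (skewProduct θ f ^ k) (θ^[k]) := by
  have : LocallyConnectedSpace M :=
    ChartedSpace.locallyConnectedSpace (EuclideanSpace ℝ (Fin m)) M
  refine ⟨inferInstance, fun k _ C => ?_⟩
  set φ := skewProduct θ f with hφ
  have hφskew : ⇑φ = skewMap (fun w x => f w x) α := by
    ext1 p
    exact Prod.ext rfl (hθ p.2)
  have hφc : Continuous φ := by
    rw [hφskew]
    exact (continuous_apply_prod hf).prodMk (by fun_prop)
  have hφc' : Continuous φ.symm := (hφc.homeoOfEquivCompactToT2).symm.continuous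
  have hφα : ∀ p, (φ p).2 = p.2 + α := fun p => by rw [hφskew]; rfl
  obtain ⟨s, hs⟩ := exists_component_perm hf
  have hsφ : ∀ p, ConnectedComponents.mk (φ p).1 = s (ConnectedComponents.mk p.1) :=
    fun p => hs p.2 p.1
  have : ∀ p : M × Ω, (𝓝[≠] p).NeBot := neBot_nhdsNE_prod
  have hpos := htrans.isPositivelyTransitive hφc hφc'
  obtain ⟨p₀, hp₀⟩ := htrans
  have hst : ∀ c, ∃ n : ℤ, (s ^ n) (ConnectedComponents.mk p₀.1) = c := fun c => by
    obtain ⟨x, hx⟩ := ConnectedComponents.surjective_coe c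
    obtain ⟨_, hn, n, rfl⟩ := hp₀.inter_open_nonempty (componentSet c ×ˢ univ)
      ((isOpen_componentSet c).prod isOpen_univ) ⟨(x, 0), hx, mem_univ _⟩
    exact ⟨n, by rw [← zpow_component hsφ]; exact hn.1⟩
  have hk := pow_card_of_transitive C s _ hst
  have hkc : ∀ c n, (s ^ n) c = c ↔ k ∣ n := hk
  refine ⟨?_, fun i => ⟨?_, ?_⟩⟩
  · have hσ : ∀ i, ∃ n : ℤ, ((C.symm.permCongr s) ^ n) 0 = i := fun i => by
      obtain ⟨a, ha⟩ := hst (C 0)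
      obtain ⟨b, hb⟩ := hst (C i)
      refine ⟨b - a, ?_⟩
      have h1 : (C.symm.permCongr s) ^ (b - a) = C.symm.permCongr (s ^ (b - a)) :=
        (map_zpow C.symm.permCongrHom s (b - a)).symm
      rw [h1, Equiv.permCongr_apply, Equiv.symm_symm, ← ha, ← Equiv.Perm.mul_apply, ← zpow_add,
        sub_add_cancel, hb, Equiv.symm_apply_apply]
    refine (existsUnique_congr fun τ => ?_).1 (cyclic_enumeration (C.symm.permCongr s) hσ)
    refine and_congr Iff.rfl (forall_congr' fun i => ?_)
    rw [image_componentSet hsφ, componentSet_prod_injective, Equiv.permCongr_apply,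
      Equiv.symm_symm, Equiv.symm_apply_eq]
  · have := image_componentSet (ψ := φ ^ k) (s := s ^ k)
      (fun p => by simpa using zpow_component hsφ k p) (C i)
    rwa [(hkc _ k).2 dvd_rfl] at this
  · intro U V hU hV hU0 hV0 hUC hVC
    obtain ⟨x, hx⟩ := hU0
    obtain ⟨y, hy⟩ := hV0
    obtain ⟨ε₁, hε₁, hεU⟩ := Metric.isOpen_iff.1 hU x hx
    obtain ⟨ε₂, hε₂, hεV⟩ := Metric.isOpen_iff.1 hV y hy
    obtain ⟨δ, hδ, hshadow⟩ := exists_shadowing g hθ hf hA (lt_min hε₁ hε₂)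
    obtain ⟨N, hN⟩ := exists_forall_reach_component hφc hφα hpos hsφ (hkc (C i)) hδ
    refine ⟨N + 1, N.succ_pos, fun n hn w => ?_⟩
    have hr := hN n (by omega) w x (hUC hx) y (hVC hy)
    obtain ⟨k', rfl⟩ : ∃ k', k = k' + 1 := ⟨k - 1, (Nat.succ_pred (NeZero.ne k)).symm⟩
    rw [Equiv.Perm.coe_pow, hφskew] at hr
    -- A chain for the `k`-th iterate is refined to a chain for the map itself, to which shadowing
    -- applies; the shadowing orbit lies over the orbit of `w` itself.
    obtain ⟨z, hz, hzn⟩ := hshadow _ _ _ _ hr.of_iterate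
    refine ⟨(skewMap (fun w x => f w x) α)^[(k' + 1) * n] (z, w), ⟨(z, w), ⟨?_, rfl⟩, ?_⟩, ?_, ?_⟩
    · exact hεU (hz.trans_le (min_le_left _ _))
    · rw [Equiv.Perm.coe_pow, hφskew, Function.iterate_mul]
    · exact hεV (hzn.trans_le (min_le_right _ _))
    · rw [skewMap_iterate_snd, mem_singleton_iff, ← Function.iterate_mul]
      generalize (k' + 1) * n = l
      induction l with
      | zero => simp
      | succ l ih =>
        rw [Function.iterate_succ_apply', ← ih, hθ, succ_nsmul]
        simp only
        abel

end Main

end FiberAnosov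

end

theorem theorem2p4 {m : ℕ} {M : Type*} [TopologicalSpace M] [T2Space M] [CompactSpace M]
    [ChartedSpace (EuclideanSpace ℝ (Fin m)) M] [IsManifold (𝓡 m) ∞ M]
    (g : Bundle.ContMDiffRiemannianMetric (𝓡 m) ∞ (EuclideanSpace ℝ (Fin m))
      (fun x : M => TangentSpace (𝓡 m) x))
    {ι : Type*} [Countable ι] [Nonempty ι] (α : ι → UnitAddCircle)
    (hα : FiberAnosov.IsIrrationalRotation α)
    (θ : (ι → UnitAddCircle) ≃ₜ (ι → UnitAddCircle)) (hθ : ∀ w, θ w = w + α)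
    (f : (ι → UnitAddCircle) → M ≃ₘ^2⟮𝓡 m, 𝓡 m⟯ M) (hf : Continuous f)
    (φ : Equiv.Perm (M × (ι → UnitAddCircle))) (hφ : φ = FiberAnosov.skewProduct θ f)
    (htrans : FiberAnosov.IsTransitive φ)
    (hAnosov : FiberAnosov.IsAnosovOnFibers g θ f) :
    Finite (ConnectedComponents M) ∧
    ∀ (k : ℕ) [NeZero k] (C : Fin k ≃ ConnectedComponents M),
      (∃! τ : Equiv.Perm (Fin k), τ 0 = 0 ∧
        ∀ i : Fin k, φ '' (FiberAnosov.componentSet (C (τ i)) ×ˢ univ) =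
          FiberAnosov.componentSet (C (τ (i + 1))) ×ˢ univ) ∧
      ∀ i : Fin k,
        (φ ^ k) '' (FiberAnosov.componentSet (C i) ×ˢ univ) =
          FiberAnosov.componentSet (C i) ×ˢ univ ∧
        FiberAnosov.IsMixingOnFibers (FiberAnosov.componentSet (C i)) (φ ^ k) (θ^[k]) := by
  subst hφ
  have : SecondCountableTopology M :=
    ChartedSpace.secondCountable_of_sigmaCompact (EuclideanSpace ℝ (Fin m)) M
  have : Nontrivial (ι → UnitAddCircle) := by
    obtain ⟨i⟩ := ‹Nonempty ι›
    -- If `α` were zero, the combination with a single coefficient `1` would vanish. Nontriviality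
    -- of the torus excludes isolated points in the product.
    refine ⟨α, 0, fun h => hα (Finsupp.single i 1) (by simp) ?_⟩
    simp [h]
  -- Any compatible distance will do, since chains and shadowing are only used for all small sizes.
  let _ : MetricSpace M := TopologicalSpace.metrizableSpaceMetric M
  exact FiberAnosov.spectral_decomposition g hθ hf htrans hAnosov
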